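/- **Proposition 2 (coverage when every shared base station is active).** *Model.* Operators $0,1,\dots,K$ own base stations (BSs) in the plane; the BSs of operator $k$ form a homogeneous Poisson point process of intensity $\lambda_k\ge 0$, independently for different $k$. The buyer, operator $0$, shares the BSs of a set $\mathcal N\subseteq\{1,\dots,K\}$ of sellers. Let $\mathcal F$ be the set of all BSs of the operators in $\mathcal N\cup\{0\}$, and $\lambda=\lambda_0+\sum_{k\in\mathcal N}\lambda_k>0$. A typical user of the buyer is at the origin and is served by the nearest BS in $\mathcal F$ (Assumption 1), at distance $r_0$. Every BS in $\mathcal F$ transmits in the spectrum of the buyer (Assumption 2.1), so that $\lambda_I=\lambda_A=\lambda$. With transmit power $p>0$, noise variance $\sigma^2\ge 0$ and path-loss exponent $\alpha>2$, $$\mathrm{SINR}=\frac{g_0\,r_0^{-\alpha}\,p}{I+\sigma^2},\qquad I=\sum_i g_i\,r_i^{-\alpha}\,p ,$$ the sum being over the BSs of $\mathcal F$ other than the serving one, at distances $r_i$. Here $g_0$ is exponential with mean $1$ (Rayleigh fading), the $g_i$ are identically distributed with an arbitrary law on $(0,\infty)$ such that $\mathbb E[g_i^{2/\alpha}]<\infty$,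 and all the gains are independent of each other and of the BSs. For a threshold $T>0$ let $P_c=\Pr(\mathrm{SINR}>T)$, and put $B=T\sigma^2/p$ and $$\beta=\frac{2(T/p)^{2/\alpha}}{\alpha}\,\mathbb E_g\Big[g^{2/\alpha}\Big(\Gamma\big(-\tfrac2\alpha,\tfrac{Tg}{p}\big)-\Gamma\big(-\tfrac2\alpha\big)\Big)\Big],\qquad \Gamma(a,x)=\int_x^\infty t^{a-1}e^{-t}\,dt,$$ where $g$ has the law of $p\,g_i$, the total gain of an interfering link including transmit power. *Claim.* The expectation defining $\beta$ is finite, and $$P_c=\pi\lambda\int_0^\infty\exp\{-(\pi\lambda\beta z+Bz^{\alpha/2})\}\,dz .$$ The general approximation $\pi\lambda\int_0^\infty e^{-(Az+Bz^{\alpha/2})}dz\simeq\pi\lambda\big[A+\tfrac\alpha2B^{2/\alpha}/\Gamma(\tfrac2\alpha)\big]^{-1}$, taken at $A=\pi\lambda\beta$, is $$\widehat P_c=\Big[\beta+\frac{\alpha}{2\pi\lambda}\frac{B^{2/\alpha}}{\Gamma(2/\alpha)}\Big]^{-1},$$ and it approximates $P_c$ in the following sense: always $\widehat P_c\le P_c\le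 2\widehat P_c$; and $P_c/\widehat P_c\to1$ both in the interference-limited regime $B/(\pi\lambda\beta)^{\alpha/2}\to0$ and in the noise-limited regime $B/(\pi\lambda\beta)^{\alpha/2}\to\infty$, uniformly in all the other data for fixed $\alpha$: for every $\varepsilon>0$ there is $\delta>0$ depending only on $\alpha$ and $\varepsilon$ such that $|P_c/\widehat P_c-1|\le\varepsilon$ whenever $B\le\delta(\pi\lambda\beta)^{\alpha/2}$ or $(\pi\lambda\beta)^{\alpha/2}\le\delta B$. -/

import Mathlib

open MeasureTheory ProbabilityTheory Set

noncomputable section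

/-- The Euclidean plane, in which the base stations live. -/
abbrev Plane : Type := EuclideanSpace ℝ (Fin 2)

/-- A point process on `E` given by a measurable enumeration of its points: in the outcome `ω` its
points are `pt i ω` for `i < num ω`, where the number of points may be `0`, finite or infinite. -/
structure PointProcess (Ω E : Type*) [MeasurableSpace Ω] [MeasurableSpace E] where
  num : Ω → ℕ∞
  pt : ℕ → Ω → E
  measurable_num : Measurable num
  measurable_pt : ∀ i, Measurable (pt i)

/-- The number of points of the process that lie in `A`. -/
def PointProcess.count {Ω E : Type*} [MeasurableSpace Ω] [MeasurableSpace E]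
    (Φ : PointProcess Ω E) (A : Set E) (ω : Ω) : ℕ∞ :=
  {i : ℕ | (i : ℕ∞) < Φ.num ω ∧ Φ.pt i ω ∈ A}.encard

/-- `Φ` is a Poisson point process with intensity measure `m` under the probability `P`: the number
of points in a set of finite measure `m A` is Poisson with mean `m A`, and the numbers of points in
finitely many pairwise disjoint sets are independent. -/
structure PointProcess.IsPoisson {Ω E : Type*} [MeasurableSpace Ω] [MeasurableSpace E]
    (Φ : PointProcess Ω E) (m : Measure E) (P : Measure Ω) : Prop where
  law : ∀ A : Set E, MeasurableSet A → m A < ⊤ → ∀ n : ℕ,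
    P {ω | Φ.count A ω = n} = poissonMeasure (m A).toNNReal {n}
  indep : ∀ (n : ℕ) (A : Fin n → Set E), (∀ i, MeasurableSet (A i)) →
    Pairwise (fun i j => Disjoint (A i) (A j)) → iIndepFun (fun i => Φ.count (A i)) P

/-- The downlink of the buyer operator `0` in a system of operators `0, …, K`.
The `i`-th base station of operator `k` is labelled `(k, i)`.
The typical user is at the origin of the plane. -/
structure Downlink (Ω : Type*) [MeasurableSpace Ω] where
  /-- the number of operators other than the buyer -/
  K : ℕ
  /-- the sellers that share their infrastructure with the buyer -/
  sellers : Finset (Fin (K + 1))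
  /-- the base stations of each operator -/
  bs : Fin (K + 1) → PointProcess Ω Plane
  /-- the number of base stations per unit area of each operator -/
  intensity : Fin (K + 1) → ℝ
  /-- whether a base station transmits in the spectrum of the buyer -/
  active : Fin (K + 1) × ℕ → Ω → Bool
  /-- the channel power gain of the link to the serving base station -/
  g₀ : Ω → ℝ
  /-- the channel power gains of the links to interfering base stations -/
  g : Fin (K + 1) × ℕ → Ω → ℝ
  /-- the distribution of the gains of the interfering links -/
  gainLaw : Measure ℝ
  /-- transmit power -/
  p : ℝ
  /-- the square `σ ^ 2` is the noise variance -/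
  σ : ℝ
  /-- the SINR threshold -/
  T : ℝ
  /-- the path-loss exponent -/
  α : ℝ

namespace Downlink

variable {Ω : Type*} [MeasurableSpace Ω] (S : Downlink Ω)

/-- The operators whose base stations the typical user may use: the buyer and the sharing sellers. -/
def operators : Finset (Fin (S.K + 1)) := insert 0 S.sellers

/-- The net intensity of the base stations that the typical user can associate with. -/
def netIntensity : ℝ := ∑ k ∈ S.operators, S.intensity k

/-- The label `b` belongs to an existing base station of the enlarged set. -/
def Available (ω : Ω) (b : Fin (S.K + 1) × ℕ) : Prop :=
  b.1 ∈ S.operators ∧ (b.2 : ℕ∞) < (S.bs b.1).num ω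

/-- The distance from the typical user to the base station `b`. -/
def dist (ω : Ω) (b : Fin (S.K + 1) × ℕ) : ℝ := ‖(S.bs b.1).pt b.2 ω‖

/-- The typical user associates with the nearest base station of the enlarged set. -/
def IsServing (ω : Ω) (b : Fin (S.K + 1) × ℕ) : Prop :=
  S.Available ω b ∧ ∀ b', S.Available ω b' → S.dist ω b ≤ S.dist ω b'

open Classical in
/-- The interference at the typical user when `b` is its serving base station: the sum of the
powers received from all the other available base stations that are active in the spectrum of the
buyer. -/
def interference (ω : Ω) (b : Fin (S.K + 1) × ℕ) : ENNReal :=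
  ∑' b', if S.Available ω b' ∧ b' ≠ b ∧ S.active b' ω = true then
    ENNReal.ofReal (S.g b' ω * S.dist ω b' ^ (-S.α) * S.p) else 0

/-- The signal to interference plus noise ratio when `b` is the serving base station. -/
def sinr (ω : Ω) (b : Fin (S.K + 1) × ℕ) : ENNReal :=
  ENNReal.ofReal (S.g₀ ω * S.dist ω b ^ (-S.α) * S.p) /
    (S.interference ω b + ENNReal.ofReal (S.σ ^ 2))

/-- The coverage probability: the probability that the SINR of the typical user, served by its
nearest base station, exceeds the threshold. -/
def coverage (P : Measure Ω) : ℝ :=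
  P.real {ω | ∃ b, S.IsServing ω b ∧ ENNReal.ofReal S.T < S.sinr ω b}

/-- The standing assumptions of the system model. -/
structure IsModel (P : Measure Ω) : Prop where
  p_pos : 0 < S.p
  T_pos : 0 < S.T
  two_lt_α : 2 < S.α
  buyer_notMem : 0 ∉ S.sellers
  intensity_nonneg : ∀ k, 0 ≤ S.intensity k
  netIntensity_pos : 0 < S.netIntensity
  /-- the base stations of each operator form a homogeneous Poisson point process -/
  poisson : ∀ k, (S.bs k).IsPoisson (ENNReal.ofReal (S.intensity k) • volume) P
  /-- the processes of different operators are independent -/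
  indep_bs : iIndepFun
    (fun k ω (A : {A : Set Plane // MeasurableSet A}) => (S.bs k).count (A : Set Plane) ω) P
  /-- Rayleigh fading of the serving link, with mean gain one -/
  rayleigh : HasLaw S.g₀ (expMeasure 1) P
  /-- the interfering links have identically distributed gains -/
  gain : ∀ b, HasLaw (S.g b) S.gainLaw P
  gain_pos : ∀ᵐ x ∂S.gainLaw, 0 < x
  gain_moment : Integrable (fun x : ℝ => x ^ (2 / S.α)) S.gainLaw
  /-- the gains of all the links are independent -/
  indep_gain : iIndepFun (fun o : Option (Fin (S.K + 1) × ℕ) => o.elim S.g₀ S.g) P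
  /-- the gains are independent of the positions of the base stations -/
  indep_gain_bs : IndepFun (fun ω => (S.g₀ ω, fun b => S.g b ω))
    (fun ω => (fun k => (S.bs k).num ω, fun b : Fin (S.K + 1) × ℕ => (S.bs b.1).pt b.2 ω)) P

/-- Every base station of the buyer and of the sharing sellers serves a user of the buyer, so that
all of them transmit in the spectrum of the buyer; thus the interfering base stations have the same
intensity as those that the typical user can associate with. -/
def AllActive (P : Measure Ω) : Prop :=
  ∀ᵐ ω ∂P, ∀ b, S.Available ω b → S.active b ω = true

end Downlink

/-- The upper incomplete Gamma function `Γ(a, x)`. -/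
def upperGamma (a x : ℝ) : ℝ := ∫ t in Ioi x, t ^ (a - 1) * Real.exp (-t)

namespace Downlink

variable {Ω : Type*} [MeasurableSpace Ω] (S : Downlink Ω)

/-- The distribution of the total gain of an interfering link, transmit power included. -/
def powerLaw : Measure ℝ := S.gainLaw.map (fun x => S.p * x)

/-- The function of the total gain `x` whose mean occurs in `β`. -/
def betaIntegrand (x : ℝ) : ℝ :=
  x ^ (2 / S.α) * (upperGamma (-(2 / S.α)) (S.T * x / S.p) - Real.Gamma (-(2 / S.α)))

/-- The coefficient `β`. -/
def beta : ℝ := 2 * (S.T / S.p) ^ (2 / S.α) / S.α * ∫ x, S.betaIntegrand x ∂S.powerLaw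

/-- The coefficient `B`. -/
def B : ℝ := S.T * S.σ ^ 2 / S.p

/-- The closed-form approximation of the coverage probability. -/
def coverageApprox : ℝ :=
  (S.beta + S.α / (2 * Real.pi * S.netIntensity) *
    (S.B ^ (2 / S.α) / Real.Gamma (2 / S.α)))⁻¹

end Downlink

/-- The closed-form approximation of `π l ∫ exp (-(A z + B z ^ (α / 2))) dz` over `0 < z`, which
is the harmonic interpolation between its values at `B = 0` and at `A = 0`. -/
def integralApprox (α l A B : ℝ) : ℝ :=
  Real.pi * l * (A + α / 2 * (B ^ (2 / α) / Real.Gamma (2 / α)))⁻¹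

end

/-! Put ρ = πλ and a = α/2, and measure base stations by their squared distance z to the origin.
Area in the disc ‖x‖² ≤ z grows linearly in z, so for radial functions the shared base stations
behave like a homogeneous Poisson process of rate ρ on (0, ∞). A server at squared distance z covers
the user iff g₀ > B z^a + Σ T (z/zᵢ)^a gᵢ. Given the positions, the exponential tail of g₀ turns
this into exp(-B z^a) times a product of Laplace transforms of the gain law. The Laplace functional
over the points beyond z then yields exp(-ρz(β - 1)), where β - 1 is the mean of ∫ (1 - exp(-T g
y^(-a))) dy over y > 1, an incomplete Gamma expression (`interferenceArea`, `IsModel.beta_eq`). With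
exp(-ρz) for the absence of closer points, the integrand is exp(-(ρβz + B z^a)).

No law of the nearest distance and no Palm calculus is used. Squared distances are cut into cells of
width d. Coverage implies that, for some cell, there is no closer point, the cell is nonempty, and
the link withstands noise and farther interference when the server is moved to the inner end of the
cell (`IsModel.exists_upper_cell`). Conversely it is implied by a single point in the cell and a
link that withstands them with the server at the outer end (`IsModel.covered_of_lower_cell`). Void
and counting conditions are encoded as extra weights in the same Laplace functional (`cellWeight`),
so the cell probabilities are explicit exponentials, up to factors ρd + O(d²). Their sums are
Riemann sums, and d → 0 gives the formula (`eq_mul_integral_of_riemann_bounds`).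

For the approximation, let J(A, B) be the integral of exp(-(Az + Bz^a)) over z > 0 and 1/D its value
at A = 0. Then J ≤ min(1/A, 1/D), which is at most 2/(A + D) and is close to 1/(A + D) when A/D is
very small or very large. The bound J ≥ 1/(A + D) is a single-crossing argument: exp(-Bz^a) and
exp(-Dz) have equal integrals and cross once, and the decreasing factor exp(-Az) favours the one
that is larger near 0 (`inv_add_le_integral_exp_neg_add_rpow`). -/

noncomputable section

/-! ### Exponentials on [0, ∞] and Laplace transforms. -/

/-- The function `x ↦ exp (-x)` on `[0, ∞]`. -/
def expNeg (x : ENNReal) : ℝ := ((EReal.exp x)⁻¹).toReal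

theorem EReal.one_le_exp_coe_ennreal (x : ENNReal) : 1 ≤ EReal.exp x :=
  EReal.one_le_exp_iff.2 (EReal.coe_ennreal_nonneg x)

theorem EReal.exp_coe_ennreal_inv_ne_top (x : ENNReal) : (EReal.exp x)⁻¹ ≠ ⊤ :=
  ENNReal.inv_ne_top.2 (zero_lt_one.trans_le (EReal.one_le_exp_coe_ennreal x)).ne'

@[simp] theorem expNeg_zero : expNeg 0 = 1 := by simp [expNeg]

@[simp] theorem expNeg_top : expNeg ⊤ = 0 := by simp [expNeg]

theorem expNeg_ofReal {x : ℝ} (hx : 0 ≤ x) : expNeg (ENNReal.ofReal x) = Real.exp (-x) := by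
  rw [expNeg, EReal.coe_ennreal_ofReal, max_eq_left hx, EReal.exp_coe, ENNReal.toReal_inv,
    ENNReal.toReal_ofReal (Real.exp_pos x).le, Real.exp_neg]

theorem expNeg_add (x y : ENNReal) : expNeg (x + y) = expNeg x * expNeg y := by
  rw [expNeg, EReal.coe_ennreal_add, EReal.exp_add, ENNReal.mul_inv, ENNReal.toReal_mul, expNeg,
    expNeg]
  · exact Or.inl (zero_lt_one.trans_le (EReal.one_le_exp_coe_ennreal x)).ne'
  · exact Or.inr (zero_lt_one.trans_le (EReal.one_le_exp_coe_ennreal y)).ne'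

theorem expNeg_sum {ι : Type*} (s : Finset ι) (f : ι → ENNReal) :
    expNeg (∑ i ∈ s, f i) = ∏ i ∈ s, expNeg (f i) := by
  classical
  induction s using Finset.induction_on with
  | empty => simp
  | insert i s hi ih => rw [Finset.sum_insert hi, Finset.prod_insert hi, expNeg_add, ih]

theorem expNeg_nonneg (x : ENNReal) : 0 ≤ expNeg x := ENNReal.toReal_nonneg

theorem expNeg_antitone : Antitone expNeg := by
  intro x y h
  refine ENNReal.toReal_mono (EReal.exp_coe_ennreal_inv_ne_top x) (ENNReal.inv_le_inv.2 ?_)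
  exact EReal.exp_monotone (EReal.coe_ennreal_le_coe_ennreal_iff.2 h)

theorem expNeg_le_one (x : ENNReal) : expNeg x ≤ 1 := by
  simpa using expNeg_antitone (zero_le : 0 ≤ x)

theorem expNeg_pos {x : ENNReal} (hx : x ≠ ⊤) : 0 < expNeg x := by
  rw [← ENNReal.ofReal_toReal hx, expNeg_ofReal ENNReal.toReal_nonneg]
  exact Real.exp_pos _

theorem norm_expNeg_le_one (x : ENNReal) : ‖expNeg x‖ ≤ 1 := by
  rw [Real.norm_of_nonneg (expNeg_nonneg x)]
  exact expNeg_le_one x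

theorem continuous_expNeg : Continuous expNeg := by
  refine ENNReal.continuousOn_toReal.comp_continuous (continuous_inv.comp ?_)
    EReal.exp_coe_ennreal_inv_ne_top
  exact EReal.expOrderIso.continuous.comp continuous_coe_ennreal_ereal

@[fun_prop] theorem measurable_expNeg : Measurable expNeg := continuous_expNeg.measurable

theorem integrable_expNeg {Ω : Type*} [MeasurableSpace Ω] {P : Measure Ω} [IsFiniteMeasure P]
    {f : Ω → ENNReal} (hf : AEMeasurable f P) : Integrable (fun ω => expNeg (f ω)) P :=
  .of_bound (measurable_expNeg.comp_aemeasurable hf).aestronglyMeasurable 1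
    (.of_forall fun _ => norm_expNeg_le_one _)

theorem tendsto_integral_expNeg {Ω ι : Type*} [MeasurableSpace Ω] {P : Measure Ω}
    [IsFiniteMeasure P] {l : Filter ι} [l.IsCountablyGenerated] {F : ι → Ω → ENNReal}
    {f : Ω → ENNReal} (hF : ∀ i, AEMeasurable (F i) P)
    (h : ∀ ω, Filter.Tendsto (fun i => F i ω) l (nhds (f ω))) :
    Filter.Tendsto (fun i => ∫ ω, expNeg (F i ω) ∂P) l (nhds (∫ ω, expNeg (f ω) ∂P)) :=
  tendsto_integral_filter_of_dominated_convergence (fun _ => 1)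
    (.of_forall fun i => (measurable_expNeg.comp_aemeasurable (hF i)).aestronglyMeasurable)
    (.of_forall fun _ => .of_forall fun _ => norm_expNeg_le_one _) (integrable_const 1)
    (.of_forall fun ω => (continuous_expNeg.tendsto _).comp (h ω))

/-- The inverse of `expNeg` on `(0, 1]`. -/
def negLog (x : ℝ) : ENNReal := ENNReal.ofReal (-Real.log x)

@[fun_prop] theorem measurable_negLog : Measurable negLog := by
  unfold negLog; fun_prop

theorem expNeg_negLog {x : ℝ} (h0 : 0 < x) (h1 : x ≤ 1) : expNeg (negLog x) = x := by
  rw [negLog, expNeg_ofReal (neg_nonneg.2 (Real.log_nonpos h0.le h1)), neg_neg, Real.exp_log h0]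

/-- The Laplace transform of the positive part of a distribution. -/
def laplace (μ : Measure ℝ) (a : ENNReal) : ℝ := ∫ x, expNeg (a * ENNReal.ofReal x) ∂μ

theorem laplace_le_one (μ : Measure ℝ) [IsProbabilityMeasure μ] (a : ENNReal) :
    laplace μ a ≤ 1 := by
  calc laplace μ a ≤ ∫ _, (1 : ℝ) ∂μ :=
        integral_mono (integrable_expNeg (by fun_prop)) (integrable_const 1)
          fun _ => expNeg_le_one _
    _ = 1 := by simp

theorem laplace_pos (μ : Measure ℝ) [IsProbabilityMeasure μ] {a : ENNReal} (ha : a ≠ ⊤) :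
    0 < laplace μ a := by
  have h : ∀ x, 0 < expNeg (a * ENNReal.ofReal x) := fun x =>
    expNeg_pos (ENNReal.mul_ne_top ha ENNReal.ofReal_ne_top)
  rw [laplace, integral_pos_iff_support_of_nonneg (fun x => (h x).le)
    (integrable_expNeg (by fun_prop))]
  have : Function.support (fun x => expNeg (a * ENNReal.ofReal x)) = univ :=
    eq_univ_of_forall fun x => (h x).ne'
  rw [this]
  simp

theorem measurable_laplace (μ : Measure ℝ) [IsProbabilityMeasure μ] : Measurable (laplace μ) := by
  have : Measurable (fun q : ENNReal × ℝ => expNeg (q.1 * ENNReal.ofReal q.2)) := by fun_prop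
  exact (this.stronglyMeasurable.integral_prod_right (ν := μ)).measurable

/-- Finite subfamilies factor by independence, and dominated convergence with bound 1 passes to the
whole family. Writing each factor as `expNeg (w i)` replaces an infinite product by a sum in [0, ∞],
which always converges. -/
theorem ProbabilityTheory.iIndepFun.integral_expNeg_tsum {Ω ι : Type*} [Countable ι]
    [MeasurableSpace Ω] {P : Measure Ω} [IsProbabilityMeasure P] {X : ι → Ω → ENNReal}
    (hX : ∀ i, Measurable (X i)) (h : iIndepFun X P) {w : ι → ENNReal}
    (hw : ∀ i, ∫ ω, expNeg (X i ω) ∂P = expNeg (w i)) :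
    ∫ ω, expNeg (∑' i, X i ω) ∂P = expNeg (∑' i, w i) := by
  have hs : ∀ s : Finset ι, ∫ ω, expNeg (∑ i ∈ s, X i ω) ∂P = expNeg (∑ i ∈ s, w i) := by
    intro s
    simp_rw [expNeg_sum, ← hw]
    have h' : iIndepFun (fun (i : s) ω => expNeg (X i ω)) P :=
      (h.precomp (g := fun i : s => (i : ι)) Subtype.val_injective).comp
        (fun _ => expNeg) (fun _ => measurable_expNeg)
    have := h'.integral_fun_prod_eq_prod_integral
      (fun i => (measurable_expNeg.comp (hX i)).aestronglyMeasurable)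
    rw [← Finset.prod_coe_sort s (fun i => ∫ ω, expNeg (X i ω) ∂P), ← this]
    congr 1 with ω
    exact (Finset.prod_coe_sort s (fun i => expNeg (X i ω))).symm
  refine tendsto_nhds_unique (tendsto_integral_expNeg (l := Filter.atTop)
    (F := fun (s : Finset ι) ω => ∑ i ∈ s, X i ω)
    (fun s => (Finset.measurable_fun_sum s fun i _ => hX i).aemeasurable)
    fun ω => ENNReal.summable.hasSum) ?_
  simp_rw [hs]
  exact (continuous_expNeg.tendsto _).comp ENNReal.summable.hasSum

/-! ### An exponential signal against independent interference. -/

theorem expMeasure_one_real_lt_ofReal (y : ENNReal) :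
    (expMeasure 1).real {x | y < ENNReal.ofReal x} = expNeg y := by
  have := isProbabilityMeasure_expMeasure zero_lt_one
  rcases eq_or_ne y ⊤ with rfl | hy
  · simp
  have h : {x : ℝ | y < ENNReal.ofReal x} = (Iic y.toReal)ᶜ := by
    ext x
    simp only [mem_ofPred_eq, mem_compl_iff, mem_Iic, not_le]
    exact ENNReal.lt_ofReal_iff_toReal_lt hy
  rw [h, measureReal_compl measurableSet_Iic, ← cdf_eq_real, cdf_expMeasure_eq zero_lt_one,
    if_pos ENNReal.toReal_nonneg]
  nth_rw 2 [← ENNReal.ofReal_toReal hy]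
  rw [expNeg_ofReal ENNReal.toReal_nonneg]
  simp

theorem ProbabilityTheory.IndepFun.measureReal_lt_ofReal_exponential {Ω : Type*}
    [MeasurableSpace Ω] {P : Measure Ω} [IsProbabilityMeasure P] {X : Ω → ℝ} {Y : Ω → ENNReal}
    (hX : HasLaw X (expMeasure 1) P) (hY : Measurable Y) (h : IndepFun X Y P) :
    P.real {ω | Y ω < ENNReal.ofReal (X ω)} = ∫ ω, expNeg (Y ω) ∂P := by
  have := isProbabilityMeasure_expMeasure zero_lt_one
  have hms : MeasurableSet {q : ENNReal × ℝ | q.1 < ENNReal.ofReal q.2} :=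
    measurableSet_lt (by fun_prop) (by fun_prop)
  have hmap := (indepFun_iff_map_prod_eq_prod_map_map hY.aemeasurable hX.aemeasurable).1 h.symm
  rw [hX.map_eq] at hmap
  have h1 : P {ω | Y ω < ENNReal.ofReal (X ω)} =
      (P.map Y).prod (expMeasure 1) {q : ENNReal × ℝ | q.1 < ENNReal.ofReal q.2} := by
    rw [← hmap, Measure.map_apply_of_aemeasurable (hY.aemeasurable.prodMk hX.aemeasurable) hms]
    rfl
  have h2 : ∀ y : ENNReal, expMeasure 1 (Prod.mk y ⁻¹' {q : ENNReal × ℝ | q.1 < ENNReal.ofReal q.2})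
      = ENNReal.ofReal (expNeg y) := by
    intro y
    rw [← expMeasure_one_real_lt_ofReal, ofReal_measureReal]
    rfl
  rw [measureReal_def, h1, Measure.prod_apply hms]
  simp_rw [h2]
  rw [lintegral_map (by fun_prop) hY, integral_eq_lintegral_of_nonneg_ae
    (.of_forall fun _ => expNeg_nonneg _) (measurable_expNeg.comp hY).aestronglyMeasurable]

/-- A family is independent of the member that is split off from it. -/
theorem ProbabilityTheory.iIndepFun.indepFun_option {Ω ι : Type*} [MeasurableSpace Ω]
    {P : Measure Ω} {X : Ω → ℝ} {Y : ι → Ω → ℝ} (hX : Measurable X) (hY : ∀ i, Measurable (Y i))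
    (h : iIndepFun (fun o : Option ι => o.elim X Y) P) : IndepFun X (fun ω i => Y i ω) P := by
  have hm : ∀ o : Option ι, MeasurableSpace.comap (o.elim X Y) inferInstance ≤
      (inferInstance : MeasurableSpace Ω) := by
    rintro (_ | i)
    · exact hX.comap_le
    · exact (hY i).comap_le
  have := indep_iSup_of_disjoint hm h.iIndep (S := {none}) (T := {none}ᶜ)
    disjoint_compl_right
  refine indep_of_indep_of_le_right (indep_of_indep_of_le_left this ?_) ?_
  · exact le_iSup₂_of_le none rfl le_rfl
  · refine measurable_iff_comap_le.1 (@measurable_pi_lambda _ _ _ (_) _ _ fun i => ?_)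
    refine measurable_iff_comap_le.2 ?_
    exact le_iSup₂_of_le (f := fun (o : Option ι) (_ : o ∈ ({none}ᶜ : Set (Option ι))) =>
      MeasurableSpace.comap (o.elim X Y) inferInstance) (some i) (by simp) le_rfl

/-- The exponential tail turns the comparison into the Laplace transform of the right-hand noise and
interference, which factors over the independent gains. This is the fading computation for frozen
positions. -/
theorem measureReal_interference_lt {Ω ι : Type*} [Countable ι] [MeasurableSpace Ω]
    {P : Measure Ω} [IsProbabilityMeasure P] {μ : Measure ℝ} {X : Ω → ℝ} {Y : ι → Ω → ℝ}
    (hXm : Measurable X) (hYm : ∀ i, Measurable (Y i)) (hX : HasLaw X (expMeasure 1) P)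
    (hY : ∀ i, HasLaw (Y i) μ P) (h : iIndepFun (fun o : Option ι => o.elim X Y) P)
    (c : ENNReal) {a : ι → ENNReal} (ha : ∀ i, a i ≠ ⊤) :
    P.real {ω | c + ∑' i, a i * ENNReal.ofReal (Y i ω) < ENNReal.ofReal (X ω)} =
      expNeg c * expNeg (∑' i, negLog (laplace μ (a i))) := by
  have hind : IndepFun X (fun ω => c + ∑' i, a i * ENNReal.ofReal (Y i ω)) P :=
    (h.indepFun_option hXm hYm).comp (ψ := fun y : ι → ℝ => c + ∑' i, a i * ENNReal.ofReal (y i))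
      measurable_id (by fun_prop)
  rw [hind.measureReal_lt_ofReal_exponential hX (by fun_prop)]
  simp_rw [expNeg_add]
  rw [integral_const_mul]
  congr 1
  have hY' : iIndepFun (fun i ω => a i * ENNReal.ofReal (Y i ω)) P :=
    (h.precomp (g := some) (Option.some_injective ι)).comp
      (fun i x => a i * ENNReal.ofReal x) (fun i => by fun_prop)
  refine hY'.integral_expNeg_tsum (fun i => by fun_prop) fun i => ?_
  have := (hY i).isProbabilityMeasure_iff.1 ‹_›
  rw [expNeg_negLog (laplace_pos μ (ha i)) (laplace_le_one μ _), laplace]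
  exact (hY i).integral_comp (f := fun x => expNeg (a i * ENNReal.ofReal x))
    (measurable_expNeg.comp (by fun_prop)).aestronglyMeasurable

/-! ### Poisson processes and their Laplace functional. -/

namespace PointProcess

variable {Ω E : Type*} [MeasurableSpace Ω] [MeasurableSpace E]

open Classical in
/-- The sum of a function over the points of a point process. -/
def sum (Φ : PointProcess Ω E) (w : E → ENNReal) (ω : Ω) : ENNReal :=
  ∑' i : ℕ, if (i : ℕ∞) < Φ.num ω then w (Φ.pt i ω) else 0

variable (Φ : PointProcess Ω E)

theorem measurable_sum {w : E → ENNReal} (hw : Measurable w) : Measurable (Φ.sum w) := by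
  classical
  refine Measurable.tsum fun i => Measurable.ite ?_ (hw.comp (Φ.measurable_pt i))
    measurable_const
  exact Φ.measurable_num (t := {n | (i : ℕ∞) < n}) (MeasurableSet.of_discrete)

theorem toENNReal_count (A : Set E) (ω : Ω) :
    (Φ.count A ω : ENNReal) = Φ.sum (A.indicator 1) ω := by
  classical
  rw [count, ← ENNReal.tsum_set_one, tsum_subtype _ fun _ => (1 : ENNReal), sum]
  congr 1 with i
  by_cases h : (i : ℕ∞) < Φ.num ω <;> by_cases h' : Φ.pt i ω ∈ A <;> simp [indicator, h, h']

theorem measurable_count {A : Set E} (hA : MeasurableSet A) : Measurable (Φ.count A) := by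
  have h : Measurable fun ω => (Φ.count A ω : ENNReal) := by
    simp_rw [toENNReal_count]
    exact Φ.measurable_sum (measurable_one.indicator hA)
  refine measurable_to_countable' fun n => ?_
  have : Φ.count A ⁻¹' {n} = (fun ω => (Φ.count A ω : ENNReal)) ⁻¹' {(n : ENNReal)} := by
    ext ω; simp
  rw [this]
  exact h (measurableSet_singleton _)

theorem sum_finset_sum {ι : Type*} (s : Finset ι) (w : ι → E → ENNReal) (ω : Ω) :
    Φ.sum (fun x => ∑ j ∈ s, w j x) ω = ∑ j ∈ s, Φ.sum (w j) ω := by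
  simp only [sum]
  rw [← Summable.tsum_finsetSum fun _ _ => ENNReal.summable]
  congr 1 with i
  split_ifs <;> simp

theorem sum_const_mul (c : ENNReal) (w : E → ENNReal) (ω : Ω) :
    Φ.sum (fun x => c * w x) ω = c * Φ.sum w ω := by
  simp only [sum]
  rw [← ENNReal.tsum_mul_left]
  congr 1 with i
  split_ifs <;> simp

theorem sum_simpleFunc (f : SimpleFunc E ENNReal) (ω : Ω) :
    Φ.sum f ω = ∑ v ∈ f.range, v * (Φ.count (f ⁻¹' {v}) ω : ENNReal) := by
  classical
  simp_rw [toENNReal_count, ← sum_const_mul, ← sum_finset_sum]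
  congr 1 with x
  rw [Finset.sum_eq_single (f x)] <;> simp +contextual [indicator, eq_comm]

theorem tendsto_sum {f : ℕ → E → ENNReal} {w : E → ENNReal} (hf : Monotone f)
    (h : ∀ x, Filter.Tendsto (fun n => f n x) Filter.atTop (nhds (w x))) (ω : Ω) :
    Filter.Tendsto (fun n => Φ.sum (f n) ω) Filter.atTop (nhds (Φ.sum w ω)) := by
  simp only [sum, ← lintegral_count]
  refine lintegral_tendsto_of_tendsto_of_monotone (fun n => by fun_prop)
    (.of_forall fun i m n hmn => ?_) (.of_forall fun i => ?_)
  · dsimp only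
    split_ifs
    exacts [hf hmn _, le_rfl]
  · split_ifs
    exacts [h _, tendsto_const_nhds]

namespace IsPoisson

variable {Φ} {m : Measure E} {P : Measure Ω} [IsProbabilityMeasure P]

/-- The Poisson law is prescribed at finite values only; since these already carry total mass one,
an infinite count has probability zero. -/
theorem map_count (h : Φ.IsPoisson m P) {A : Set E} (hA : MeasurableSet A) (hm : m A < ⊤) :
    P.map (Φ.count A) = (poissonMeasure (m A).toNNReal).map (Nat.cast : ℕ → ℕ∞) := by
  have hmeas : Measurable (Nat.cast : ℕ → ℕ∞) := measurable_from_top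
  have h1 : ∀ n : ℕ, P.map (Φ.count A) {(n : ℕ∞)} =
      (poissonMeasure (m A).toNNReal).map (Nat.cast : ℕ → ℕ∞) {(n : ℕ∞)} := by
    intro n
    rw [Measure.map_apply (Φ.measurable_count hA) (.of_discrete),
      Measure.map_apply hmeas (.of_discrete)]
    have : (Nat.cast : ℕ → ℕ∞) ⁻¹' {(n : ℕ∞)} = {n} := by ext; simp
    rw [this, ← h.law A hA hm n]
    rfl
  have hN : range (Nat.cast : ℕ → ℕ∞) = {⊤}ᶜ := by
    ext n; rw [mem_compl_singleton_iff, mem_range, ENat.ne_top_iff_exists]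
  have : IsProbabilityMeasure (P.map (Φ.count A)) :=
    Measure.isProbabilityMeasure_map (Φ.measurable_count hA).aemeasurable
  have : IsProbabilityMeasure ((poissonMeasure (m A).toNNReal).map (Nat.cast : ℕ → ℕ∞)) :=
    Measure.isProbabilityMeasure_map hmeas.aemeasurable
  have h2 : P.map (Φ.count A) (range (Nat.cast : ℕ → ℕ∞)) =
      (poissonMeasure (m A).toNNReal).map (Nat.cast : ℕ → ℕ∞) (range (Nat.cast : ℕ → ℕ∞)) := by
    rw [← iUnion_singleton_eq_range]
    rw [measure_iUnion, measure_iUnion]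
    · simp_rw [h1]
    all_goals first
      | (intro i j hij; simpa using hij)
      | (intro i; exact .of_discrete)
  have h3 : ∀ (Q : Measure ℕ∞) [IsProbabilityMeasure Q],
      Q {⊤} = 1 - Q (range (Nat.cast : ℕ → ℕ∞)) := by
    intro Q _
    rw [hN, ← prob_compl_eq_one_sub (.of_discrete), compl_compl]
  refine Measure.ext_of_singleton fun n => ?_
  induction n using ENat.recTopCoe with
  | top => rw [h3, h3, h2]
  | coe n => exact h1 n

/-- The generating function of a Poisson variable. The value c = ⊤ is allowed and, as ⊤ * 0 = 0,
yields the void probability. -/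
theorem integral_expNeg_mul_count (h : Φ.IsPoisson m P) {A : Set E} (hA : MeasurableSet A)
    (hm : m A < ⊤) (c : ENNReal) :
    ∫ ω, expNeg (c * (Φ.count A ω : ENNReal)) ∂P =
      expNeg (m A * ENNReal.ofReal (1 - expNeg c)) := by
  have hc : ∀ n : ℕ, expNeg (c * (n : ENNReal)) = expNeg c ^ n := by
    intro n
    induction n with
    | zero => simp
    | succ n ih => rw [Nat.cast_succ, mul_add, expNeg_add, ih, mul_one, pow_succ]
  have h1 : ∫ ω, expNeg (c * (Φ.count A ω : ENNReal)) ∂P =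
      ∫ n, expNeg (c * (n : ENNReal)) ∂(poissonMeasure (m A).toNNReal) := by
    rw [← integral_map (f := fun n : ℕ∞ => expNeg (c * (n : ENNReal)))
      (Φ.measurable_count hA).aemeasurable (Measurable.of_discrete).aestronglyMeasurable,
      h.map_count hA hm, integral_map (measurable_from_top).aemeasurable
      (Measurable.of_discrete).aestronglyMeasurable]
    simp
  have hx : expNeg (m A * ENNReal.ofReal (1 - expNeg c)) =
      Real.exp (-((m A).toReal * (1 - expNeg c))) := by
    rw [← expNeg_ofReal (mul_nonneg ENNReal.toReal_nonneg (sub_nonneg.2 (expNeg_le_one c))),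
      ENNReal.ofReal_mul ENNReal.toReal_nonneg, ENNReal.ofReal_toReal hm.ne]
  have hsum : HasSum (fun n : ℕ => Real.exp (-(m A).toReal) * (m A).toReal ^ n / n.factorial *
      expNeg c ^ n) (Real.exp (-((m A).toReal * (1 - expNeg c)))) := by
    have := (NormedSpace.expSeries_div_hasSum_exp ((m A).toReal * expNeg c)).mul_left
      (Real.exp (-(m A).toReal))
    rw [← Real.exp_eq_exp_ℝ, ← Real.exp_add] at this
    have hexp : -((m A).toReal * (1 - expNeg c)) =
      -(m A).toReal + (m A).toReal * expNeg c := by ring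
    rw [hexp]
    refine this.congr_fun fun n => ?_
    rw [mul_pow]; ring
  rw [h1, hx, integral_poissonMeasure]
  simp_rw [hc]
  exact hsum.tsum_eq

theorem integral_expNeg_sum_simpleFunc (h : Φ.IsPoisson m P) (f : SimpleFunc E ENNReal)
    (hf : ∀ v ≠ 0, m (f ⁻¹' {v}) < ⊤) :
    ∫ ω, expNeg (Φ.sum f ω) ∂P = expNeg (∫⁻ x, ENNReal.ofReal (1 - expNeg (f x)) ∂m) := by
  classical
  -- The level set of 0 may have infinite measure, where the law of the count is not available; it
  -- contributes nothing and is dropped.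
  set R := f.range.filter (· ≠ 0)
  have hsum : ∀ ω, Φ.sum f ω = ∑ v ∈ R, v * (Φ.count (f ⁻¹' {v}) ω : ENNReal) := by
    intro ω
    rw [sum_simpleFunc, Finset.sum_filter_of_ne]
    intro v _ hv
    exact left_ne_zero_of_mul hv
  have hR : ∀ v ∈ R, v ≠ 0 := fun v hv => (Finset.mem_filter.1 hv).2
  have hint : ∫⁻ x, ENNReal.ofReal (1 - expNeg (f x)) ∂m =
      ∑ v ∈ R, m (f ⁻¹' {v}) * ENNReal.ofReal (1 - expNeg v) := by
    have h1 := (f.map fun v => ENNReal.ofReal (1 - expNeg v)).lintegral_eq_lintegral m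
    rw [SimpleFunc.map_lintegral] at h1
    simp only [SimpleFunc.map_apply] at h1
    rw [h1, Finset.sum_filter_of_ne]
    · exact Finset.sum_congr rfl fun _ _ => mul_comm _ _
    · rintro v _ hv rfl
      simp at hv
  have hind : iIndepFun (fun (v : R) ω => expNeg (v * (Φ.count (f ⁻¹' {(v : ENNReal)}) ω : ENNReal))) P := by
    let e := R.equivFin
    have h1 := h.indep R.card (fun i => f ⁻¹' {(e.symm i : ENNReal)})
      (fun i => f.measurableSet_fiber _) (fun i j hij => by
        refine Disjoint.preimage f (disjoint_singleton.2 fun hv => hij ?_)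
        exact e.symm.injective (Subtype.ext hv))
    have h2 := h1.precomp e.injective
    have h3 := h2.comp (fun (v : R) (n : ℕ∞) => expNeg (v * (n : ENNReal)))
      (fun _ => Measurable.of_discrete)
    simpa [Function.comp_def] using h3
  simp_rw [hsum, hint, expNeg_sum]
  have := hind.integral_fun_prod_eq_prod_integral (fun v => Measurable.aestronglyMeasurable
    ((Measurable.of_discrete (f := fun n : ℕ∞ => expNeg (v * (n : ENNReal)))).comp
      (Φ.measurable_count (f.measurableSet_fiber _))))
  rw [← Finset.prod_coe_sort]
  simp_rw [← Finset.prod_coe_sort R (fun v => expNeg (v * (Φ.count (f ⁻¹' {v}) _ : ENNReal)))]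
  rw [this]
  refine Finset.prod_congr rfl fun v _ => ?_
  exact h.integral_expNeg_mul_count (f.measurableSet_fiber _) (hf _ (hR _ v.2)) _

end IsPoisson

/-- The Laplace functional of a superposition of independent Poisson processes. -/
theorem integral_expNeg_superposition {ι : Type*} {P : Measure Ω} [IsProbabilityMeasure P]
    {Φ : ι → PointProcess Ω E} {m : ι → Measure E} (hΦ : ∀ k, (Φ k).IsPoisson (m k) P)
    (hind : iIndepFun (fun k ω (A : {A : Set E // MeasurableSet A}) =>
      (Φ k).count (A : Set E) ω) P)
    {B : ℕ → Set E} (hBm : Monotone B) (hB : ∀ n, MeasurableSet (B n)) (hBu : ⋃ n, B n = univ)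
    (hmB : ∀ k n, m k (B n) < ⊤) (s : Finset ι) {w : E → ENNReal} (hw : Measurable w) :
    ∫ ω, expNeg (∑ k ∈ s, (Φ k).sum w ω) ∂P =
      expNeg (∑ k ∈ s, ∫⁻ x, ENNReal.ofReal (1 - expNeg (w x)) ∂(m k)) := by
  classical
  -- Restricting to `B n` gives the nonzero level sets finite measure, and the approximation still
  -- increases to `w`.
  let f : ℕ → SimpleFunc E ENNReal := fun n => (SimpleFunc.eapprox w n).restrict (B n)
  have hfx : ∀ n x, f n x = (B n).indicator (SimpleFunc.eapprox w n) x := fun n x => by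
    simp only [f]
    rw [SimpleFunc.restrict_apply _ (hB n)]
  have hfm : Monotone fun n => (f n : E → ENNReal) := by
    intro i j hij x
    simp only [hfx]
    refine (indicator_le_indicator_of_subset (hBm hij) (fun _ => zero_le) x).trans ?_
    exact indicator_le_indicator (SimpleFunc.monotone_eapprox w hij x)
  have hft : ∀ x, Filter.Tendsto (fun n => f n x) Filter.atTop (nhds (w x)) := by
    intro x
    have h1 : Filter.Tendsto (fun n => SimpleFunc.eapprox w n x) Filter.atTop (nhds (w x)) := by
      rw [← SimpleFunc.iSup_eapprox_apply hw x]
      exact tendsto_atTop_iSup fun i j hij => SimpleFunc.monotone_eapprox w hij x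
    obtain ⟨N, hN⟩ := mem_iUnion.1 (hBu ▸ mem_univ x)
    refine h1.congr' ?_
    filter_upwards [Filter.eventually_ge_atTop N] with n hn
    rw [hfx, indicator_of_mem (hBm hn hN)]
  have hfin : ∀ k n, ∀ v ≠ 0, m k (f n ⁻¹' {v}) < ⊤ := by
    intro k n v hv
    refine (measure_mono fun x hx => ?_).trans_lt (hmB k n)
    by_contra hxB
    rw [mem_preimage, hfx, indicator_of_notMem hxB] at hx
    exact hv hx.symm
  have hkey : ∀ n, ∫ ω, expNeg (∑ k ∈ s, (Φ k).sum (f n) ω) ∂P =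
      expNeg (∑ k ∈ s, ∫⁻ x, ENNReal.ofReal (1 - expNeg (f n x)) ∂(m k)) := by
    intro n
    -- Independence of the processes is assumed for their counts, and for a simple function the sum
    -- depends on finitely many counts.
    have h1 : iIndepFun (fun (k : s) ω => expNeg ((Φ k).sum (f n) ω)) P := by
      have h2 := (hind.precomp (g := fun k : s => (k : ι)) Subtype.val_injective).comp
        (fun (_ : s) (c : {A : Set E // MeasurableSet A} → ℕ∞) =>
          expNeg (∑ v ∈ (f n).range,
            v * (c ⟨f n ⁻¹' {v}, (f n).measurableSet_fiber v⟩ : ENNReal)))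
        (fun _ => measurable_expNeg.comp (Finset.measurable_fun_sum _ fun v _ =>
          ((Measurable.of_discrete (f := fun n : ℕ∞ => v * (n : ENNReal))).comp
            (measurable_pi_apply _))))
      simpa only [Function.comp_def, sum_simpleFunc] using h2
    simp_rw [expNeg_sum]
    have h3 := h1.integral_fun_prod_eq_prod_integral (fun k =>
      (measurable_expNeg.comp ((Φ k).measurable_sum (f n).measurable)).aestronglyMeasurable)
    simp_rw [← fun ω => Finset.prod_coe_sort s (fun k => expNeg ((Φ k).sum (f n) ω))]
    rw [h3, Finset.prod_coe_sort s (fun k => ∫ ω, expNeg ((Φ k).sum (f n) ω) ∂P)]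
    exact Finset.prod_congr rfl fun k _ =>
      (hΦ k).integral_expNeg_sum_simpleFunc (f n) (hfin k n)
  have hl : Filter.Tendsto (fun n => ∫ ω, expNeg (∑ k ∈ s, (Φ k).sum (f n) ω) ∂P) Filter.atTop
      (nhds (∫ ω, expNeg (∑ k ∈ s, (Φ k).sum w ω) ∂P)) :=
    tendsto_integral_expNeg
      (fun n => (Finset.measurable_fun_sum s fun k _ =>
        (Φ k).measurable_sum (f n).measurable).aemeasurable)
      fun ω => tendsto_finsetSum s fun k _ => (Φ k).tendsto_sum hfm hft ω
  refine tendsto_nhds_unique hl ?_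
  simp_rw [hkey]
  refine (continuous_expNeg.tendsto _).comp (tendsto_finsetSum s fun k _ => ?_)
  refine lintegral_tendsto_of_tendsto_of_monotone
    (fun n => (Measurable.ennreal_ofReal (measurable_const.sub
      (measurable_expNeg.comp (f n).measurable))).aemeasurable)
    (.of_forall fun x i j hij => ENNReal.ofReal_le_ofReal
      (sub_le_sub_left (expNeg_antitone (hfm hij x)) 1)) (.of_forall fun x => ?_)
  exact (ENNReal.continuous_ofReal.tendsto _).comp
    (tendsto_const_nhds.sub ((continuous_expNeg.tendsto _).comp (hft x)))

end PointProcess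

/-! ### The incomplete Gamma function and the mean effect of interference. -/

theorem integrableOn_upperGamma {c x : ℝ} (hc : c ≤ 1) (hx : 0 < x) :
    IntegrableOn (fun t : ℝ => t ^ (c - 1) * Real.exp (-t)) (Ioi x) := by
  refine Integrable.mono' ((integrableOn_exp_neg_Ioi x).const_mul (x ^ (c - 1)))
    (by fun_prop) ?_
  filter_upwards [ae_restrict_mem measurableSet_Ioi] with t ht
  have ht0 : 0 < t := hx.trans ht
  rw [Real.norm_of_nonneg (by positivity)]
  exact mul_le_mul_of_nonneg_right (Real.rpow_le_rpow_of_nonpos hx (le_of_lt ht) (by linarith))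
    (Real.exp_pos _).le

theorem hasDerivAt_upperGamma {c x : ℝ} (hc : c ≤ 1) (hx : 0 < x) :
    HasDerivAt (upperGamma c) (-(x ^ (c - 1) * Real.exp (-x))) x := by
  have hx2 : 0 < x / 2 := by positivity
  have hcont : ContinuousOn (fun t : ℝ => t ^ (c - 1) * Real.exp (-t)) (Ioi 0) :=
    fun t ht => ((Real.continuousAt_rpow_const _ _ (Or.inl (ne_of_gt ht))).mul
      (by fun_prop)).continuousWithinAt
  have heq : upperGamma c =ᶠ[nhds x] fun y => upperGamma c (x / 2) -
      ∫ t in (x / 2)..y, t ^ (c - 1) * Real.exp (-t) := by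
    filter_upwards [lt_mem_nhds (by linarith : x / 2 < x)] with y hy
    rw [eq_sub_iff_add_eq, add_comm]
    exact intervalIntegral.integral_interval_add_Ioi (integrableOn_upperGamma hc hx2)
      (integrableOn_upperGamma hc (hx2.trans hy))
  refine HasDerivAt.congr_of_eventuallyEq ?_ heq
  refine HasDerivAt.const_sub _ (intervalIntegral.integral_hasDerivAt_right ?_ ?_ ?_)
  · refine (hcont.mono fun t ht => ?_).intervalIntegrable
    rw [uIcc_of_le (by linarith)] at ht
    exact hx2.trans_le ht.1
  · exact hcont.stronglyMeasurableAtFilter isOpen_Ioi x hx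
  · exact hcont.continuousAt (Ioi_mem_nhds hx)

/-- Integration by parts with the primitive t^(-s) e^(-t). It raises the negative parameter to 1 -
s, where for s < 1 the integral also converges at 0. -/
theorem upperGamma_one_sub {s x : ℝ} (hs0 : 0 < s) (hx : 0 < x) :
    upperGamma (1 - s) x = x ^ (-s) * Real.exp (-x) - s * upperGamma (-s) x := by
  have hd : ∀ t ∈ Ici x, HasDerivAt (fun t : ℝ => t ^ (-s) * Real.exp (-t))
      (-(s * (t ^ (-s - 1) * Real.exp (-t))) - t ^ ((1 - s) - 1) * Real.exp (-t)) t := by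
    intro t ht
    have ht0 : 0 < t := hx.trans_le ht
    have h1 := (Real.hasDerivAt_rpow_const (p := -s) (Or.inl ht0.ne')).mul
      (hasDerivAt_neg t).exp
    refine h1.congr_deriv ?_
    rw [show (1 - s) - 1 = -s by ring]; ring
  have hi1 := (integrableOn_upperGamma (c := -s) (by linarith) hx).const_mul s
  have hi2 := integrableOn_upperGamma (c := 1 - s) (by linarith) hx
  have hlim : Filter.Tendsto (fun t : ℝ => t ^ (-s) * Real.exp (-t)) Filter.atTop (nhds 0) := by
    simpa using (tendsto_rpow_neg_atTop hs0).mul Real.tendsto_exp_neg_atTop_nhds_zero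
  have h := integral_Ioi_of_hasDerivAt_of_tendsto' hd (hi1.neg.sub hi2) hlim
  have h' := integral_sub (μ := volume.restrict (Ioi x)) hi1.neg hi2
  simp only [Pi.neg_apply] at h'
  rw [h', integral_neg, integral_const_mul] at h
  simp only [upperGamma]
  linarith

theorem Gamma_one_sub {s : ℝ} (hs0 : 0 < s) : Real.Gamma (1 - s) = -(s * Real.Gamma (-s)) := by
  rw [show 1 - s = -s + 1 by ring, Real.Gamma_add_one (by linarith)]; ring

theorem Gamma_sub_upperGamma {c x : ℝ} (hc : 0 < c) (hx : 0 ≤ x) :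
    Real.Gamma c - upperGamma c x = ∫ t in Ioc 0 x, t ^ (c - 1) * Real.exp (-t) := by
  have hi : IntegrableOn (fun t : ℝ => t ^ (c - 1) * Real.exp (-t)) (Ioi 0) := by
    simpa only [mul_comm] using Real.GammaIntegral_convergent hc
  have h := setIntegral_union (Ioc_disjoint_Ioi_same (a := (0 : ℝ)) (b := x)) measurableSet_Ioi
    (hi.mono_set Ioc_subset_Ioi_self) (hi.mono_set (Ioi_subset_Ioi hx))
  rw [Ioc_union_Ioi_eq_Ioi hx] at h
  have hG : Real.Gamma c = ∫ t in Ioi 0, t ^ (c - 1) * Real.exp (-t) := by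
    rw [Real.Gamma_eq_integral hc]; simp only [mul_comm]
  rw [hG, upperGamma, h]; ring

/-- The integral of `(1 - exp (-t)) * t ^ (-s - 1)` over `(0, x]`, in closed form. -/
def singularGamma (s x : ℝ) : ℝ := upperGamma (-s) x - Real.Gamma (-s) - x ^ (-s) / s

/-- The recursions of Γ(·, x) and Γ raise the parameter to 1 - s. The terms singular at 0 cancel and
leave two differences, which `tendsto_singularGamma` and `interferenceArea_le` control. -/
theorem mul_singularGamma {s x : ℝ} (hs0 : 0 < s) (hx : 0 < x) :
    s * singularGamma s x =
      (Real.Gamma (1 - s) - upperGamma (1 - s) x) - x ^ (-s) * (1 - Real.exp (-x)) := by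
  rw [upperGamma_one_sub hs0 hx, Gamma_one_sub hs0, singularGamma]
  field_simp
  ring

theorem tendsto_singularGamma {s : ℝ} (hs0 : 0 < s) (hs1 : s < 1) :
    Filter.Tendsto (singularGamma s) (nhdsWithin 0 (Ioi 0)) (nhds 0) := by
  have hpow : Filter.Tendsto (fun x : ℝ => x ^ (1 - s)) (nhdsWithin 0 (Ioi 0)) (nhds 0) := by
    have h := (Real.continuousAt_rpow_const 0 (1 - s) (Or.inr (by linarith))).tendsto
    rw [Real.zero_rpow (by linarith)] at h
    exact h.mono_left nhdsWithin_le_nhds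
  have h1 : Filter.Tendsto (fun x : ℝ => Real.Gamma (1 - s) - upperGamma (1 - s) x)
      (nhdsWithin 0 (Ioi 0)) (nhds 0) := by
    refine squeeze_zero' ?_ ?_ (by simpa using hpow.div_const (1 - s))
    · filter_upwards [self_mem_nhdsWithin] with x hx
      rw [Gamma_sub_upperGamma (by linarith) (le_of_lt hx)]
      exact setIntegral_nonneg measurableSet_Ioc fun t ht => by have := ht.1; positivity
    · filter_upwards [self_mem_nhdsWithin] with x hx
      have hx' : (0 : ℝ) < x := hx
      rw [Gamma_sub_upperGamma (by linarith) hx'.le]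
      have hi : IntegrableOn (fun t : ℝ => t ^ (1 - s - 1)) (Ioc 0 x) :=
        (intervalIntegrable_iff_integrableOn_Ioc_of_le hx'.le).1
          (intervalIntegral.intervalIntegrable_rpow' (by linarith))
      have hi' : IntegrableOn (fun t : ℝ => t ^ (1 - s - 1) * Real.exp (-t)) (Ioc 0 x) := by
        have : IntegrableOn (fun t : ℝ => t ^ (1 - s - 1) * Real.exp (-t)) (Ioi 0) := by
          simpa only [mul_comm] using Real.GammaIntegral_convergent (by linarith : 0 < 1 - s)
        exact this.mono_set Ioc_subset_Ioi_self
      calc ∫ t in Ioc 0 x, t ^ (1 - s - 1) * Real.exp (-t)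
          ≤ ∫ t in Ioc 0 x, t ^ (1 - s - 1) := by
            refine setIntegral_mono_on hi' hi measurableSet_Ioc fun t ht => ?_
            have := ht.1
            exact mul_le_of_le_one_right (by positivity) (Real.exp_le_one_iff.2 (by linarith))
        _ = x ^ (1 - s) / (1 - s) := by
            rw [← intervalIntegral.integral_of_le hx'.le, integral_rpow (Or.inl (by linarith))]
            rw [Real.zero_rpow (by linarith), sub_zero, sub_add_cancel]
  have h2 : Filter.Tendsto (fun x : ℝ => x ^ (-s) * (1 - Real.exp (-x)))
      (nhdsWithin 0 (Ioi 0)) (nhds 0) := by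
    refine squeeze_zero' ?_ ?_ hpow
    · filter_upwards [self_mem_nhdsWithin] with x hx
      have hx' : (0 : ℝ) < x := hx
      exact mul_nonneg (by positivity) (sub_nonneg.2 (Real.exp_le_one_iff.2 (by linarith)))
    · filter_upwards [self_mem_nhdsWithin] with x hx
      have hx' : (0 : ℝ) < x := hx
      rw [show 1 - s = -s + 1 by ring, Real.rpow_add_one hx'.ne']
      gcongr
      linarith [Real.add_one_le_exp (-x)]
  have h3 := ((h1.sub h2).const_mul (1 / s))
  simp only [sub_zero, mul_zero] at h3
  refine h3.congr' ?_
  filter_upwards [self_mem_nhdsWithin] with x hx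
  rw [← mul_singularGamma hs0 hx]
  field_simp

theorem hasDerivAt_singularGamma {s x : ℝ} (hs0 : 0 < s) (hx : 0 < x) :
    HasDerivAt (singularGamma s) ((1 - Real.exp (-x)) * x ^ (-s - 1)) x := by
  have h := ((hasDerivAt_upperGamma (c := -s) (by linarith) hx).sub_const (Real.Gamma (-s))).sub
    ((Real.hasDerivAt_rpow_const (p := -s) (Or.inl hx.ne')).div_const s)
  refine h.congr_deriv ?_
  rw [mul_div_assoc, neg_mul, mul_div_cancel₀ _ hs0.ne']
  ring

/-- The substitution t = x y^(-a) leads to the primitive -s x^s `singularGamma s (x y^(-a))` with s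
= 1/a. It vanishes at infinity by `tendsto_singularGamma`, and integrability follows because the
integrand is nonnegative. -/
theorem integrableOn_integral_one_sub_exp_neg {a x r : ℝ} (ha : 1 < a) (hx : 0 < x)
    (hr : 0 < r) :
    IntegrableOn (fun y : ℝ => 1 - Real.exp (-(x * y ^ (-a)))) (Ioi r) ∧
      ∫ y in Ioi r, (1 - Real.exp (-(x * y ^ (-a)))) =
        1 / a * x ^ (1 / a) * singularGamma (1 / a) (x * r ^ (-a)) := by
  have ha0 : 0 < a := by linarith
  set s := 1 / a with hs
  have hs0 : 0 < s := by positivity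
  have hs1 : s < 1 := by rw [hs, div_lt_one ha0]; exact ha
  have hd : ∀ y ∈ Ici r, HasDerivAt (fun y => -(s * x ^ s * singularGamma s (x * y ^ (-a))))
      (1 - Real.exp (-(x * y ^ (-a)))) y := by
    intro y hy
    have hy0 : 0 < y := hr.trans_le hy
    have hu : 0 < x * y ^ (-a) := by positivity
    have h := (((hasDerivAt_singularGamma hs0 hu).comp y
      ((Real.hasDerivAt_rpow_const (p := -a) (Or.inl hy0.ne')).const_mul x)).const_mul
        (s * x ^ s)).neg
    refine h.congr_deriv ?_
    have h1 : (x * y ^ (-a)) ^ (-s - 1) = x ^ (-s - 1) * y ^ (1 + a) := by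
      rw [Real.mul_rpow hx.le (by positivity), ← Real.rpow_mul hy0.le]
      congr 2
      rw [hs]; field_simp; ring
    have h2 : x ^ s * x ^ (-s - 1) * x = 1 := by
      nth_rw 3 [← Real.rpow_one x]
      rw [← Real.rpow_add hx, ← Real.rpow_add hx]
      ring_nf; simp
    have h3 : y ^ (1 + a) * y ^ (-a - 1) = 1 := by
      rw [← Real.rpow_add hy0]; ring_nf; simp
    have h4 : s * a = 1 := by rw [hs]; field_simp
    rw [h1]
    symm
    calc 1 - Real.exp (-(x * y ^ (-a))) = (1 - Real.exp (-(x * y ^ (-a)))) * (s * a) *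
          (x ^ s * x ^ (-s - 1) * x) * (y ^ (1 + a) * y ^ (-a - 1)) := by rw [h2, h3, h4]; ring
      _ = _ := by ring
  have hpos : ∀ y ∈ Ioi r, 0 ≤ 1 - Real.exp (-(x * y ^ (-a))) := by
    intro y hy
    have hy0 : 0 < y := hr.trans hy
    exact sub_nonneg.2 (Real.exp_le_one_iff.2 (neg_nonpos.2 (by positivity)))
  have hlim : Filter.Tendsto (fun y => -(s * x ^ s * singularGamma s (x * y ^ (-a))))
      Filter.atTop (nhds 0) := by
    have h1 : Filter.Tendsto (fun y : ℝ => x * y ^ (-a)) Filter.atTop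
        (nhdsWithin 0 (Ioi 0)) := by
      refine tendsto_nhdsWithin_iff.2 ⟨by simpa using (tendsto_rpow_neg_atTop ha0).const_mul x, ?_⟩
      filter_upwards [Filter.eventually_gt_atTop 0] with y hy
      exact mem_Ioi.2 (by positivity)
    simpa using (((tendsto_singularGamma hs0 hs1).comp h1).const_mul (s * x ^ s)).neg
  refine ⟨integrableOn_Ioi_deriv_of_nonneg' hd hpos hlim, ?_⟩
  rw [integral_Ioi_of_hasDerivAt_of_nonneg' hd hpos hlim]
  ring

theorem ae_one_sub_exp_neg_nonneg {a x r : ℝ} (hx : 0 ≤ x) (hr : 0 ≤ r) :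
    0 ≤ᵐ[volume.restrict (Ioi r)] fun y : ℝ => 1 - Real.exp (-(x * y ^ (-a))) := by
  filter_upwards [ae_restrict_mem measurableSet_Ioi] with y hy
  have hy0 : 0 < y := hr.trans_lt hy
  exact sub_nonneg.2 (Real.exp_le_one_iff.2 (neg_nonpos.2 (by positivity)))

theorem lintegral_one_sub_exp_neg {a x r : ℝ} (ha : 1 < a) (hx : 0 < x) (hr : 0 < r) :
    ∫⁻ y in Ioi r, ENNReal.ofReal (1 - Real.exp (-(x * y ^ (-a)))) =
      ENNReal.ofReal (1 / a * x ^ (1 / a) * singularGamma (1 / a) (x * r ^ (-a))) := by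
  obtain ⟨h1, h2⟩ := integrableOn_integral_one_sub_exp_neg ha hx hr
  rw [← h2, ofReal_integral_eq_lintegral_ofReal h1 (ae_one_sub_exp_neg_nonneg hx.le hr.le)]

theorem singularGamma_nonneg {a x : ℝ} (ha : 1 < a) (hx : 0 < x) :
    0 ≤ singularGamma (1 / a) x := by
  have h1 := (integrableOn_integral_one_sub_exp_neg ha hx one_pos).2
  rw [Real.one_rpow, mul_one] at h1
  have h2 : 0 ≤ 1 / a * x ^ (1 / a) * singularGamma (1 / a) x :=
    h1 ▸ integral_nonneg_of_ae (ae_one_sub_exp_neg_nonneg hx.le one_pos.le)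
  have ha0 : 0 < a := by linarith
  exact nonneg_of_mul_nonneg_right h2 (by positivity)

/-- The integral of `1 - exp (-(x * y ^ (-a)))` over `1 < y`, in closed form. -/
def interferenceArea (a x : ℝ) : ℝ := 1 / a * x ^ (1 / a) * singularGamma (1 / a) x

theorem interferenceArea_nonneg {a x : ℝ} (ha : 1 < a) (hx : 0 < x) :
    0 ≤ interferenceArea a x := by
  have := singularGamma_nonneg ha hx
  have ha0 : 0 < a := by linarith
  unfold interferenceArea
  positivity

theorem upperGamma_nonneg {c x : ℝ} (hx : 0 ≤ x) : 0 ≤ upperGamma c x :=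
  setIntegral_nonneg measurableSet_Ioi fun t ht => by
    have : 0 < t := hx.trans_lt ht
    positivity

/-- Discards two nonnegative terms of `mul_singularGamma`. The resulting bound by a multiple of
x^(1/a) is where the moment condition on the gains enters. -/
theorem interferenceArea_le {a x : ℝ} (ha : 1 < a) (hx : 0 < x) :
    interferenceArea a x ≤ x ^ (1 / a) * Real.Gamma (1 - 1 / a) := by
  have ha0 : 0 < a := by linarith
  have h1 := mul_singularGamma (s := 1 / a) (by positivity) hx
  have h2 : interferenceArea a x = x ^ (1 / a) * (1 / a * singularGamma (1 / a) x) := by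
    rw [interferenceArea]; ring
  rw [h2, h1]
  gcongr
  have h3 : 0 ≤ upperGamma (1 - 1 / a) x := upperGamma_nonneg hx.le
  have h4 : 0 ≤ x ^ (-(1 / a)) * (1 - Real.exp (-x)) :=
    mul_nonneg (by positivity) (sub_nonneg.2 (Real.exp_le_one_iff.2 (by linarith)))
  linarith

/-- The boundary term x^(-s)/s of `singularGamma` contributes exactly -1. Hence the integrand of β
contains, besides the interference, the 1 that accounts for the absence of points closer than the
server. -/
theorem interferenceArea_add_one {a x : ℝ} (ha : 0 < a) (hx : 0 < x) :
    interferenceArea a x + 1 =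
      1 / a * (x ^ (1 / a) * (upperGamma (-(1 / a)) x - Real.Gamma (-(1 / a)))) := by
  have h : x ^ (1 / a) * x ^ (-(1 / a)) = 1 := by
    rw [← Real.rpow_add hx, add_neg_cancel, Real.rpow_zero]
  have h2 : 1 / a * x ^ (1 / a) * (x ^ (-(1 / a)) / (1 / a)) = 1 := by
    rw [mul_div_assoc', div_eq_one_iff_eq (by positivity), mul_assoc, h, mul_one]
  rw [interferenceArea, singularGamma, mul_sub, h2]
  ring

/-- Scaling y by t: the exponent depends on t/y only, so the integral is linear in t. This is why β
does not depend on the serving distance. -/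
theorem lintegral_one_sub_exp_neg_div {a x t : ℝ} (ha : 1 < a) (hx : 0 < x) (ht : 0 < t) :
    ∫⁻ y in Ioi t, ENNReal.ofReal (1 - Real.exp (-(x * (t / y) ^ a))) =
      ENNReal.ofReal (t * interferenceArea a x) := by
  have ha0 : 0 < a := by linarith
  have h1 : ∀ y ∈ Ioi t, ENNReal.ofReal (1 - Real.exp (-(x * (t / y) ^ a))) =
      ENNReal.ofReal (1 - Real.exp (-(x * t ^ a * y ^ (-a)))) := by
    intro y hy
    have hy0 : 0 < y := ht.trans hy
    rw [Real.div_rpow ht.le hy0.le, Real.rpow_neg hy0.le, mul_assoc, div_eq_mul_inv]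
  rw [setLIntegral_congr_fun measurableSet_Ioi h1,
    lintegral_one_sub_exp_neg ha (by positivity) ht, interferenceArea,
    Real.mul_rpow hx.le (by positivity), ← Real.rpow_mul ht.le, mul_one_div_cancel ha0.ne',
    Real.rpow_one, mul_assoc x, ← Real.rpow_add ht, add_neg_cancel, Real.rpow_zero, mul_one]
  congr 1
  ring

section GainLaw

variable {μ : Measure ℝ} {a T : ℝ}

theorem integrable_interferenceArea (ha : 1 < a) (hT : 0 < T) (hμ : ∀ᵐ x ∂μ, 0 < x)
    (hm : Integrable (fun x : ℝ => x ^ (1 / a)) μ) :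
    Integrable (fun x => interferenceArea a (T * x)) μ := by
  refine Integrable.mono' (hm.const_mul (T ^ (1 / a) * Real.Gamma (1 - 1 / a))) ?_ ?_
  -- Measurability in x is read off from the integral representation, which agrees with the closed
  -- form for x > 0.
  · have hmeas : Measurable fun x : ℝ =>
        (∫⁻ y in Ioi (1 : ℝ), ENNReal.ofReal (1 - Real.exp (-(T * x * (1 / y) ^ a)))).toReal := by
      refine (Measurable.lintegral_prod_right' (ν := volume.restrict (Ioi (1 : ℝ)))
        (f := fun q : ℝ × ℝ => ENNReal.ofReal (1 - Real.exp (-(T * q.1 * (1 / q.2) ^ a))))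
        (by fun_prop)).ennreal_toReal
    refine ⟨_, hmeas.stronglyMeasurable, ?_⟩
    filter_upwards [hμ] with x hx
    rw [lintegral_one_sub_exp_neg_div ha (by positivity) one_pos, one_mul,
      ENNReal.toReal_ofReal (interferenceArea_nonneg ha (by positivity))]
  · filter_upwards [hμ] with x hx
    rw [Real.norm_of_nonneg (interferenceArea_nonneg ha (by positivity))]
    refine (interferenceArea_le ha (by positivity)).trans_eq ?_
    rw [Real.mul_rpow hT.le hx.le]
    ring

/-- Tonelli exchanges the mean over the gain with the integral over y, after which the inner
integral is `lintegral_one_sub_exp_neg_div`. -/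
theorem lintegral_one_sub_laplace [IsProbabilityMeasure μ] (ha : 1 < a) (hT : 0 < T) (hμ : ∀ᵐ x ∂μ, 0 < x)
    (hm : Integrable (fun x : ℝ => x ^ (1 / a)) μ) {t : ℝ} (ht : 0 < t) :
    ∫⁻ y in Ioi t, ENNReal.ofReal (1 - laplace μ (ENNReal.ofReal (T * (t / y) ^ a))) =
      ENNReal.ofReal (t * ∫ x, interferenceArea a (T * x) ∂μ) := by
  have h1 : ∀ c, ENNReal.ofReal (1 - laplace μ c) =
      ∫⁻ x, ENNReal.ofReal (1 - expNeg (c * ENNReal.ofReal x)) ∂μ := by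
    intro c
    have hi : Integrable (fun x => expNeg (c * ENNReal.ofReal x)) μ :=
      integrable_expNeg (by fun_prop)
    have hi' : Integrable (fun x => 1 - expNeg (c * ENNReal.ofReal x)) μ :=
      (integrable_const 1).sub hi
    rw [← ofReal_integral_eq_lintegral_ofReal hi'
      (.of_forall fun x => sub_nonneg.2 (expNeg_le_one _)),
      integral_sub (integrable_const 1) hi, laplace]
    simp
  simp_rw [h1]
  rw [lintegral_lintegral_swap (by fun_prop)]
  have h2 : ∀ᵐ x ∂μ, ∫⁻ y in Ioi t, ENNReal.ofReal
      (1 - expNeg (ENNReal.ofReal (T * (t / y) ^ a) * ENNReal.ofReal x)) =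
      ENNReal.ofReal (t * interferenceArea a (T * x)) := by
    filter_upwards [hμ] with x hx
    rw [← lintegral_one_sub_exp_neg_div ha (by positivity) ht]
    refine setLIntegral_congr_fun measurableSet_Ioi fun y hy => ?_
    have hy0 : 0 < y := ht.trans hy
    have h3 : 0 ≤ T * (t / y) ^ a := by positivity
    rw [← ENNReal.ofReal_mul h3, expNeg_ofReal (mul_nonneg h3 hx.le)]
    congr 4
    ring
  rw [lintegral_congr_ae h2, ← integral_const_mul, ofReal_integral_eq_lintegral_ofReal
    ((integrable_interferenceArea ha hT hμ hm).const_mul t)]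
  filter_upwards [hμ] with x hx
  exact mul_nonneg ht.le (interferenceArea_nonneg ha (by positivity))

end GainLaw

/-! ### The integral with noise and its harmonic approximation. -/

section NoiseIntegral

variable {a A B : ℝ}

theorem integrableOn_exp_neg_mul_Ioi (hA : 0 < A) :
    IntegrableOn (fun z : ℝ => Real.exp (-(A * z))) (Ioi 0) := by
  simpa only [neg_mul] using integrableOn_exp_mul_Ioi (neg_lt_zero.2 hA) 0

theorem integral_exp_neg_mul_Ioi (hA : 0 < A) :
    ∫ z in Ioi (0 : ℝ), Real.exp (-(A * z)) = A⁻¹ := by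
  have h := integral_exp_mul_Ioi (neg_lt_zero.2 hA) 0
  simp only [mul_zero, Real.exp_zero, neg_div_neg_eq, one_div, neg_mul] at h
  exact h

theorem integrableOn_exp_neg_add_rpow (hA : 0 < A) (hB : 0 ≤ B) :
    IntegrableOn (fun z : ℝ => Real.exp (-(A * z + B * z ^ a))) (Ioi 0) := by
  refine Integrable.mono' (integrableOn_exp_neg_mul_Ioi hA) (by fun_prop) ?_
  filter_upwards [ae_restrict_mem measurableSet_Ioi] with z hz
  have hz0 : (0 : ℝ) < z := hz
  rw [Real.norm_of_nonneg (Real.exp_pos _).le, Real.exp_le_exp]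
  have : 0 ≤ B * z ^ a := by positivity
  linarith

theorem integral_exp_neg_add_rpow_le_inv (hA : 0 < A) (hB : 0 ≤ B) :
    ∫ z in Ioi (0 : ℝ), Real.exp (-(A * z + B * z ^ a)) ≤ A⁻¹ := by
  rw [← integral_exp_neg_mul_Ioi hA]
  refine setIntegral_mono_on (integrableOn_exp_neg_add_rpow hA hB)
    (integrableOn_exp_neg_mul_Ioi hA) measurableSet_Ioi fun z hz => ?_
  have hz0 : (0 : ℝ) < z := hz
  have : 0 ≤ B * z ^ a := by positivity
  exact Real.exp_le_exp.2 (by linarith)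

theorem integral_exp_neg_mul_rpow_eq_inv (ha : 0 < a) (hB : 0 < B) :
    ∫ z in Ioi (0 : ℝ), Real.exp (-(B * z ^ a)) =
      (a * (B ^ (1 / a) / Real.Gamma (1 / a)))⁻¹ := by
  have h := integral_exp_neg_mul_rpow ha hB
  rw [Real.Gamma_add_one (by positivity), neg_div, Real.rpow_neg hB.le] at h
  simp only [neg_mul] at h
  rw [h, mul_inv, inv_div]
  ring

theorem integrableOn_exp_neg_mul_rpow (ha : 0 < a) (hB : 0 < B) :
    IntegrableOn (fun z : ℝ => Real.exp (-(B * z ^ a))) (Ioi 0) := by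
  -- A nonintegrable function would have Bochner integral 0, but the known value is positive.
  refine not_imp_comm.1 integral_undef ?_
  have hG := Real.Gamma_pos_of_pos (one_div_pos.2 ha)
  rw [integral_exp_neg_mul_rpow_eq_inv ha hB]
  positivity

theorem integral_exp_neg_add_rpow_le_inv' (ha : 0 < a) (hA : 0 < A) (hB : 0 < B) :
    ∫ z in Ioi (0 : ℝ), Real.exp (-(A * z + B * z ^ a)) ≤
      (a * (B ^ (1 / a) / Real.Gamma (1 / a)))⁻¹ := by
  rw [← integral_exp_neg_mul_rpow_eq_inv ha hB]
  refine setIntegral_mono_on (integrableOn_exp_neg_add_rpow hA hB.le)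
    (integrableOn_exp_neg_mul_rpow ha hB) measurableSet_Ioi fun z hz => ?_
  have hz0 : (0 : ℝ) < z := hz
  have : 0 ≤ A * z := by positivity
  exact Real.exp_le_exp.2 (by linarith)

/-- Among the distributions with increasing hazard rate and given mean, the exponential one has
the largest Laplace transform: here for a Weibull distribution. -/
theorem inv_add_le_integral_exp_neg_add_rpow (ha : 1 < a) (hA : 0 < A) (hB : 0 ≤ B) :
    (A + a * (B ^ (1 / a) / Real.Gamma (1 / a)))⁻¹ ≤
      ∫ z in Ioi (0 : ℝ), Real.exp (-(A * z + B * z ^ a)) := by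
  have ha0 : 0 < a := by linarith
  rcases hB.eq_or_lt with rfl | hB
  · simp only [zero_mul, add_zero]
    rw [integral_exp_neg_mul_Ioi hA, Real.zero_rpow (by positivity)]
    simp
  have hG := Real.Gamma_pos_of_pos (one_div_pos.2 ha0)
  have hJ := integral_exp_neg_mul_rpow_eq_inv ha0 hB
  set D := a * (B ^ (1 / a) / Real.Gamma (1 / a)) with hD
  have hD0 : 0 < D := by positivity
  -- The unique positive z with B z^a = D z, where the two exponentials cross. Replacing exp(-Az) by
  -- exp(-Ac) lowers the weighted difference on both sides of c, and the unweighted difference has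
  -- integral zero.
  set c := (D / B) ^ (1 / (a - 1)) with hc
  have hc0 : 0 < c := by positivity
  have hca : c ^ (a - 1) = D / B := by
    rw [hc, ← Real.rpow_mul (by positivity), one_div_mul_cancel (by linarith), Real.rpow_one]
  have hi1 := integrableOn_exp_neg_add_rpow (a := a) hA hB.le
  have hi2 := integrableOn_exp_neg_mul_Ioi (add_pos hA hD0)
  have hi3 := integrableOn_exp_neg_mul_rpow ha0 hB
  have hi4 := integrableOn_exp_neg_mul_Ioi hD0
  have hpt : ∀ z ∈ Ioi (0 : ℝ), Real.exp (-(A * c)) *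
      (Real.exp (-(B * z ^ a)) - Real.exp (-(D * z))) ≤
      Real.exp (-(A * z + B * z ^ a)) - Real.exp (-((A + D) * z)) := by
    intro z hz
    have hz0 : (0 : ℝ) < z := hz
    have hza : B * z ^ a = z * (B * z ^ (a - 1)) := by
      rw [Real.rpow_sub_one hz0.ne']; field_simp
    have e1 : Real.exp (-(A * z + B * z ^ a)) - Real.exp (-((A + D) * z)) =
        Real.exp (-(A * z)) * (Real.exp (-(B * z ^ a)) - Real.exp (-(D * z))) := by
      rw [mul_sub, ← Real.exp_add, ← Real.exp_add]; ring_nf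
    rw [e1]
    rcases le_total z c with h | h
    · refine mul_le_mul_of_nonneg_right (Real.exp_le_exp.2 (by nlinarith)) ?_
      rw [sub_nonneg, Real.exp_le_exp, neg_le_neg_iff, hza, mul_comm D]
      refine mul_le_mul_of_nonneg_left ?_ hz0.le
      calc B * z ^ (a - 1) ≤ B * c ^ (a - 1) := by
            gcongr
        _ = D := by rw [hca]; field_simp
    · refine mul_le_mul_of_nonpos_right (Real.exp_le_exp.2 (by nlinarith)) ?_
      rw [sub_nonpos, Real.exp_le_exp, neg_le_neg_iff, hza, mul_comm D]
      refine mul_le_mul_of_nonneg_left ?_ hz0.le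
      calc D = B * c ^ (a - 1) := by rw [hca]; field_simp
        _ ≤ B * z ^ (a - 1) := by gcongr
  have h := setIntegral_mono_on ((hi3.sub hi4).const_mul (Real.exp (-(A * c))))
    (hi1.sub hi2) measurableSet_Ioi hpt
  rw [integral_const_mul, integral_sub' hi3 hi4, integral_sub' hi1 hi2, hJ,
    integral_exp_neg_mul_Ioi hD0, sub_self, mul_zero, integral_exp_neg_mul_Ioi (add_pos hA hD0)] at h
  linarith

/-- With D the second summand in the inverse, the integral is at most 1/max(A, D), and A + D ≤ 2
max(A, D). -/
theorem integral_exp_neg_add_rpow_le_two_mul (ha : 0 < a) (hA : 0 < A) (hB : 0 ≤ B) :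
    ∫ z in Ioi (0 : ℝ), Real.exp (-(A * z + B * z ^ a)) ≤
      2 * (A + a * (B ^ (1 / a) / Real.Gamma (1 / a)))⁻¹ := by
  have hG := Real.Gamma_pos_of_pos (one_div_pos.2 ha)
  have hD : 0 ≤ a * (B ^ (1 / a) / Real.Gamma (1 / a)) := by positivity
  rcases le_total (a * (B ^ (1 / a) / Real.Gamma (1 / a))) A with h | h
  · refine (integral_exp_neg_add_rpow_le_inv hA hB).trans ?_
    rw [← div_eq_mul_inv, inv_eq_one_div, div_le_div_iff₀ hA (by positivity)]
    linarith
  · have hB0 : 0 < B := by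
      refine hB.lt_of_ne' ?_
      rintro rfl
      rw [Real.zero_rpow (by positivity)] at h
      simp at h
      linarith
    have hD0 : 0 < a * (B ^ (1 / a) / Real.Gamma (1 / a)) := by positivity
    refine (integral_exp_neg_add_rpow_le_inv' ha hA hB0).trans ?_
    rw [← div_eq_mul_inv, inv_eq_one_div, div_le_div_iff₀ hD0 (by positivity)]
    linarith

/-- The bounds 1/A and 1/D make the product at most 1 + D/A or 1 + A/D. Each regime bounds the
corresponding ratio by a constant depending on a times d^(1/a). -/
theorem integral_exp_neg_add_rpow_div_le (ha : 0 < a) (hA : 0 < A) (hB : 0 ≤ B) {d : ℝ}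
    (hd : 0 < d) (h : B ≤ d * A ^ a ∨ A ^ a ≤ d * B) :
    (∫ z in Ioi (0 : ℝ), Real.exp (-(A * z + B * z ^ a))) *
      (A + a * (B ^ (1 / a) / Real.Gamma (1 / a))) ≤
      1 + max (a / Real.Gamma (1 / a)) (Real.Gamma (1 / a) / a) * d ^ (1 / a) := by
  have hG := Real.Gamma_pos_of_pos (one_div_pos.2 ha)
  have hAa : (A ^ a) ^ (1 / a) = A := by
    rw [← Real.rpow_mul hA.le, mul_one_div_cancel ha.ne', Real.rpow_one]
  rcases h with h | h
  · have h1 : B ^ (1 / a) ≤ d ^ (1 / a) * A := by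
      calc B ^ (1 / a) ≤ (d * A ^ a) ^ (1 / a) := by gcongr
        _ = _ := by rw [Real.mul_rpow hd.le (by positivity), hAa]
    calc _ ≤ A⁻¹ * (A + a * (B ^ (1 / a) / Real.Gamma (1 / a))) := by
          gcongr
          exact integral_exp_neg_add_rpow_le_inv hA hB
      _ ≤ A⁻¹ * (A + a * ((d ^ (1 / a) * A) / Real.Gamma (1 / a))) := by gcongr
      _ = 1 + a / Real.Gamma (1 / a) * d ^ (1 / a) := by field_simp
      _ ≤ _ := by gcongr; exact le_max_left _ _
  · have hB0 : 0 < B := by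
      have : 0 < A ^ a := by positivity
      exact pos_of_mul_pos_right (this.trans_le h) hd.le
    have h1 : A ≤ d ^ (1 / a) * B ^ (1 / a) := by
      calc A = (A ^ a) ^ (1 / a) := hAa.symm
        _ ≤ (d * B) ^ (1 / a) := by gcongr
        _ = _ := Real.mul_rpow hd.le hB
    calc _ ≤ (a * (B ^ (1 / a) / Real.Gamma (1 / a)))⁻¹ *
          (A + a * (B ^ (1 / a) / Real.Gamma (1 / a))) := by
          gcongr
          exact integral_exp_neg_add_rpow_le_inv' ha hA hB0
      _ ≤ (a * (B ^ (1 / a) / Real.Gamma (1 / a)))⁻¹ *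
          (d ^ (1 / a) * B ^ (1 / a) + a * (B ^ (1 / a) / Real.Gamma (1 / a))) := by gcongr
      _ = 1 + Real.Gamma (1 / a) / a * d ^ (1 / a) := by field_simp; ring
      _ ≤ _ := by gcongr; exact le_max_right _ _

end NoiseIntegral

/-! ### Riemann sums of a decreasing function. -/

section RiemannSum

theorem Ioi_zero_eq_iUnion_Ioc {d : ℝ} (hd : 0 < d) :
    Ioi (0 : ℝ) = ⋃ j : ℕ, Ioc (j * d) ((j + 1) * d) := by
  ext z
  simp only [mem_Ioi, mem_iUnion, mem_Ioc]
  constructor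
  · intro hz
    obtain ⟨n, hn⟩ := Nat.exists_eq_add_one_of_ne_zero
      (Nat.ceil_pos.2 (div_pos hz hd)).ne'
    have h1 := Nat.ceil_lt_add_one (div_pos hz hd).le
    have h2 := Nat.le_ceil (z / d)
    rw [hn] at h1 h2
    push_cast at h1 h2
    exact ⟨n, (lt_div_iff₀ hd).1 (by linarith), (div_le_iff₀ hd).1 h2⟩
  · rintro ⟨j, hj, -⟩
    exact lt_of_le_of_lt (by positivity) hj

theorem lintegral_Ioi_eq_tsum_Ioc (f : ℝ → ENNReal) {d : ℝ} (hd : 0 < d) :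
    ∫⁻ z in Ioi (0 : ℝ), f z = ∑' j : ℕ, ∫⁻ z in Ioc (j * d) ((j + 1) * d), f z := by
  rw [Ioi_zero_eq_iUnion_Ioc hd]
  refine lintegral_iUnion (fun j => measurableSet_Ioc) ?_ f
  have hm : Monotone fun j : ℕ => (j : ℝ) * d := fun i j hij => by
    dsimp only; gcongr
  have := hm.pairwise_disjoint_on_Ioc_succ
  simpa using this

theorem sum_Ioc_bounds {f : ℝ → ℝ} (hf : AntitoneOn f (Ici 0)) {d : ℝ} (hd : 0 < d) :
    ∑' j : ℕ, ENNReal.ofReal (d * f ((j + 1) * d)) ≤ ∫⁻ z in Ioi (0 : ℝ), ENNReal.ofReal (f z) ∧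
      ∫⁻ z in Ioi (0 : ℝ), ENNReal.ofReal (f z) ≤ ∑' j : ℕ, ENNReal.ofReal (d * f (j * d)) := by
  rw [lintegral_Ioi_eq_tsum_Ioc _ hd]
  have hvol : ∀ j : ℕ, volume (Ioc ((j : ℝ) * d) ((j + 1) * d)) = ENNReal.ofReal d := fun j => by
    rw [Real.volume_Ioc]; ring_nf
  constructor
  · refine ENNReal.tsum_le_tsum fun j => ?_
    rw [ENNReal.ofReal_mul hd.le, ← hvol j, mul_comm, ← setLIntegral_const]
    refine setLIntegral_mono' measurableSet_Ioc fun z hz => ENNReal.ofReal_le_ofReal ?_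
    have h0 : (0 : ℝ) ≤ j * d := by positivity
    exact hf (h0.trans hz.1.le) (h0.trans (hz.1.le.trans hz.2)) hz.2
  · refine ENNReal.tsum_le_tsum fun j => ?_
    rw [ENNReal.ofReal_mul hd.le, ← hvol j, mul_comm (volume _), ← setLIntegral_const]
    refine setLIntegral_mono' measurableSet_Ioc fun z hz => ENNReal.ofReal_le_ofReal ?_
    have h0 : (0 : ℝ) ≤ j * d := by positivity
    exact hf h0 (h0.trans hz.1.le) hz.1.le

theorem sum_eq_add_sum_succ (f : ℝ → ℝ) (d : ℝ) :
    ∑' j : ℕ, ENNReal.ofReal (d * f (j * d)) =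
      ENNReal.ofReal (d * f 0) + ∑' j : ℕ, ENNReal.ofReal (d * f ((j + 1) * d)) := by
  rw [tsum_eq_zero_add' ENNReal.summable]
  simp

theorem tendsto_exp_mul_sub_one_div (ρ : ℝ) :
    Filter.Tendsto (fun d : ℝ => (Real.exp (ρ * d) - 1) / d) (nhdsWithin 0 (Ioi 0)) (nhds ρ) := by
  have h1 : HasDerivAt (fun d : ℝ => Real.exp (ρ * d)) ρ 0 := by
    simpa using ((hasDerivAt_id (0 : ℝ)).const_mul ρ).exp
  have h2 := h1.tendsto_slope_zero_right
  refine h2.congr fun d => ?_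
  simp [div_eq_inv_mul]

/-- A quantity squeezed between Riemann sums is the integral. -/
theorem eq_mul_integral_of_riemann_bounds {f : ℝ → ℝ} (hf : AntitoneOn f (Ici 0))
    (hf0 : ∀ z, 0 ≤ f z) (hi : IntegrableOn f (Ioi 0)) {ρ C : ℝ} (hρ : 0 < ρ) (hC : 0 ≤ C)
    (hup : ∀ d > 0, ENNReal.ofReal C ≤
      ∑' j : ℕ, ENNReal.ofReal ((Real.exp (ρ * d) - 1) * f (j * d)))
    (hlo : ∀ d > 0, d ≤ 1 → ∑' j : ℕ, ENNReal.ofReal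
      ((ρ * d - d * (Real.exp (ρ * d) - 1)) * f ((j + 1) * d)) ≤ ENNReal.ofReal C) :
    C = ρ * ∫ z in Ioi 0, f z := by
  set J := ∫ z in Ioi 0, f z with hJ
  have hJ0 : 0 ≤ J := setIntegral_nonneg measurableSet_Ioi fun z _ => hf0 z
  have hJe : ∫⁻ z in Ioi (0 : ℝ), ENNReal.ofReal (f z) = ENNReal.ofReal J :=
    (ofReal_integral_eq_lintegral_ofReal hi (.of_forall hf0)).symm
  have hid : Filter.Tendsto (fun d : ℝ => d) (nhdsWithin 0 (Ioi 0)) (nhds 0) :=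
    Filter.tendsto_id.mono_left nhdsWithin_le_nhds
  have hexp : Filter.Tendsto (fun d : ℝ => Real.exp (ρ * d) - 1) (nhdsWithin 0 (Ioi 0))
      (nhds 0) := by
    have h : ContinuousAt (fun d : ℝ => Real.exp (ρ * d) - 1) 0 := by fun_prop
    have h' := h.tendsto
    simp only [mul_zero, Real.exp_zero, sub_self] at h'
    exact h'.mono_left nhdsWithin_le_nhds
  refine le_antisymm ?_ ?_
  · have hl : Filter.Tendsto (fun d : ℝ => (Real.exp (ρ * d) - 1) / d * (d * f 0 + J))
        (nhdsWithin 0 (Ioi 0)) (nhds (ρ * J)) := by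
      simpa using (tendsto_exp_mul_sub_one_div ρ).mul ((hid.mul_const (f 0)).add_const J)
    refine ge_of_tendsto hl ?_
    filter_upwards [self_mem_nhdsWithin] with d hd
    have hd0 : 0 < d := hd
    have he : 0 ≤ (Real.exp (ρ * d) - 1) / d :=
      div_nonneg (sub_nonneg.2 (Real.one_le_exp (by positivity))) hd0.le
    rw [← ENNReal.ofReal_le_ofReal_iff (by have := hf0 0; positivity)]
    calc ENNReal.ofReal C ≤ _ := hup d hd0
      _ = ENNReal.ofReal ((Real.exp (ρ * d) - 1) / d) *
          ∑' j : ℕ, ENNReal.ofReal (d * f (j * d)) := by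
          rw [← ENNReal.tsum_mul_left]
          congr 1 with j
          rw [← ENNReal.ofReal_mul he]
          congr 1
          field_simp
      _ ≤ ENNReal.ofReal ((Real.exp (ρ * d) - 1) / d) * (ENNReal.ofReal (d * f 0 + J)) := by
          rw [sum_eq_add_sum_succ, ENNReal.ofReal_add (mul_nonneg hd0.le (hf0 0)) hJ0, ← hJe]
          gcongr
          exact (sum_Ioc_bounds hf hd0).1
      _ = _ := (ENNReal.ofReal_mul he).symm
  · have hl : Filter.Tendsto (fun d : ℝ => (ρ - (Real.exp (ρ * d) - 1)) * (J - d * f 0))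
        (nhdsWithin 0 (Ioi 0)) (nhds (ρ * J)) := by
      simpa using (hexp.const_sub ρ).mul ((hid.mul_const (f 0)).const_sub J)
    refine le_of_tendsto hl ?_
    filter_upwards [self_mem_nhdsWithin, hexp.eventually_lt_const hρ,
      hid.eventually_le_const zero_lt_one] with d hd hdρ hd1
    have hd0 : 0 < d := hd
    have he : 0 ≤ ρ - (Real.exp (ρ * d) - 1) := by linarith
    rw [← ENNReal.ofReal_le_ofReal_iff hC]
    calc _ = ENNReal.ofReal (ρ - (Real.exp (ρ * d) - 1)) *
          (ENNReal.ofReal J - ENNReal.ofReal (d * f 0)) := by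
          rw [ENNReal.ofReal_mul he, ENNReal.ofReal_sub _ (mul_nonneg hd0.le (hf0 0))]
      _ ≤ ENNReal.ofReal (ρ - (Real.exp (ρ * d) - 1)) *
          ∑' j : ℕ, ENNReal.ofReal (d * f ((j + 1) * d)) := by
          gcongr
          rw [tsub_le_iff_left, ← sum_eq_add_sum_succ, ← hJe]
          exact (sum_Ioc_bounds hf hd0).2
      _ = ∑' j : ℕ, ENNReal.ofReal
            ((ρ * d - d * (Real.exp (ρ * d) - 1)) * f ((j + 1) * d)) := by
          rw [← ENNReal.tsum_mul_left]
          congr 1 with j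
          rw [← ENNReal.ofReal_mul he]
          congr 1
          ring
      _ ≤ _ := hlo d hd0 hd1

end RiemannSum

/-! ### Squared distances in the plane. -/

theorem volume_norm_sq_le (c : ℝ) :
    volume {x : Plane | ‖x‖ ^ 2 ≤ c} = ENNReal.ofReal Real.pi * ENNReal.ofReal c := by
  rcases lt_or_ge c 0 with hc | hc
  · have : {x : Plane | ‖x‖ ^ 2 ≤ c} = ∅ := by
      ext x
      simpa using hc.trans_le (sq_nonneg ‖x‖)
    rw [this, ENNReal.ofReal_of_nonpos hc.le]
    simp
  · have : {x : Plane | ‖x‖ ^ 2 ≤ c} = Metric.closedBall 0 (√c) := by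
      ext x
      simp [Real.le_sqrt (norm_nonneg x) hc]
    rw [this, EuclideanSpace.volume_closedBall_fin_two, ← ENNReal.ofReal_pow (Real.sqrt_nonneg c),
      Real.sq_sqrt hc, mul_comm]

/-- The disc of squared radius c has area πc, so both measures agree on half-lines, with finite
values, and hence on half-open intervals. -/
theorem map_norm_sq_volume :
    (volume : Measure Plane).map (fun x => ‖x‖ ^ 2) =
      ENNReal.ofReal Real.pi • volume.restrict (Ioi 0) := by
  have hm : Measurable fun x : Plane => ‖x‖ ^ 2 := by fun_prop
  have h1 : ∀ c, (volume : Measure Plane).map (fun x => ‖x‖ ^ 2) (Iic c) =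
      ENNReal.ofReal Real.pi * ENNReal.ofReal c := fun c => by
    rw [Measure.map_apply hm measurableSet_Iic, ← volume_norm_sq_le]
    rfl
  have h2 : ∀ c, (ENNReal.ofReal Real.pi • volume.restrict (Ioi (0 : ℝ))) (Iic c) =
      ENNReal.ofReal Real.pi * ENNReal.ofReal c := fun c => by
    rw [Measure.smul_apply, Measure.restrict_apply measurableSet_Iic, inter_comm, Ioi_inter_Iic,
      Real.volume_Ioc, sub_zero, smul_eq_mul]
  have hfin : ∀ c, ENNReal.ofReal Real.pi * ENNReal.ofReal c ≠ ⊤ := fun c =>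
    ENNReal.mul_ne_top ENNReal.ofReal_ne_top ENNReal.ofReal_ne_top
  refine Measure.ext_of_Ioc' _ _ (fun a b _ => ?_) fun a b hab => ?_
  · exact ((measure_mono Ioc_subset_Iic_self).trans_lt (h1 b ▸ (hfin b).lt_top)).ne
  · have hIoc : Ioc a b = Iic b \ Iic a := by ext; simp [and_comm]
    rw [hIoc, measure_sdiff (Iic_subset_Iic.2 hab.le) measurableSet_Iic.nullMeasurableSet
      (h1 a ▸ hfin a), measure_sdiff (Iic_subset_Iic.2 hab.le) measurableSet_Iic.nullMeasurableSet
      (h2 a ▸ hfin a), h1, h1, h2, h2]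

theorem lintegral_norm_sq {f : ℝ → ENNReal} (hf : Measurable f) :
    ∫⁻ x : Plane, f (‖x‖ ^ 2) = ENNReal.ofReal Real.pi * ∫⁻ z in Ioi 0, f z := by
  rw [← lintegral_map hf (by fun_prop), map_norm_sq_volume, lintegral_smul_measure, smul_eq_mul]

/-! ### Radial sums over a configuration of labelled points. -/

section Configuration

variable {n : ℕ} (s : Finset (Fin n))

/-- The label `b` belongs to an existing point of one of the processes in `s`. -/
def IsAvailable (c : (Fin n → ℕ∞) × (Fin n × ℕ → Plane)) (b : Fin n × ℕ) : Prop :=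
  b.1 ∈ s ∧ (b.2 : ℕ∞) < c.1 b.1

open Classical in
/-- The sum of a function of the squared distance to the origin over the points of the processes
in `s`, for a configuration given by the numbers and the positions of the points. -/
def radialSum (W : ℝ → ENNReal) (c : (Fin n → ℕ∞) × (Fin n × ℕ → Plane)) : ENNReal :=
  ∑' b : Fin n × ℕ, if IsAvailable s c b then W (‖c.2 b‖ ^ 2) else 0

theorem measurableSet_available (b : Fin n × ℕ) :
    MeasurableSet {c | IsAvailable s c b} := by
  have h : Measurable fun c : (Fin n → ℕ∞) × (Fin n × ℕ → Plane) => c.1 b.1 := by fun_prop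
  exact (MeasurableSet.const _).inter (h (t := {m | (b.2 : ℕ∞) < m}) (.of_discrete))

theorem measurable_radialSum {W : ℝ → ENNReal} (hW : Measurable W) :
    Measurable (radialSum s W) := by
  classical
  refine Measurable.tsum fun b => Measurable.ite (measurableSet_available s b) ?_ measurable_const
  exact hW.comp (by fun_prop)

theorem radialSum_add (V W : ℝ → ENNReal) (c : (Fin n → ℕ∞) × (Fin n × ℕ → Plane)) :
    radialSum s (fun z => V z + W z) c = radialSum s V c + radialSum s W c := by
  simp only [radialSum]
  rw [← ENNReal.tsum_add]
  congr 1 with b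
  split_ifs <;> simp

theorem radialSum_const_mul (a : ENNReal) (W : ℝ → ENNReal)
    (c : (Fin n → ℕ∞) × (Fin n × ℕ → Plane)) :
    radialSum s (fun z => a * W z) c = a * radialSum s W c := by
  simp only [radialSum]
  rw [← ENNReal.tsum_mul_left]
  congr 1 with b
  split_ifs <;> simp

theorem radialSum_indicator (A : Set ℝ) (c : (Fin n → ℕ∞) × (Fin n × ℕ → Plane)) :
    radialSum s (A.indicator 1) c =
      ({b : Fin n × ℕ | IsAvailable s c b ∧ ‖c.2 b‖ ^ 2 ∈ A}.encard : ENNReal) := by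
  classical
  rw [← ENNReal.tsum_set_one, tsum_subtype _ fun _ => (1 : ENNReal), radialSum]
  congr 1 with b
  by_cases h : IsAvailable s c b <;> by_cases h' : ‖c.2 b‖ ^ 2 ∈ A <;>
    simp [indicator, h, h']

theorem radialSum_indicator_eq_zero {A : Set ℝ} {c : (Fin n → ℕ∞) × (Fin n × ℕ → Plane)} :
    radialSum s (A.indicator 1) c = 0 ↔
      ∀ b : Fin n × ℕ, IsAvailable s c b → ‖c.2 b‖ ^ 2 ∉ A := by
  rw [radialSum_indicator]
  simp only [ENat.toENNReal_eq_zero, encard_eq_zero, eq_empty_iff_forall_notMem, mem_ofPred_eq,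
    not_and]

theorem exists_of_radialSum_indicator_eq_one {A : Set ℝ}
    {c : (Fin n → ℕ∞) × (Fin n × ℕ → Plane)} (h : radialSum s (A.indicator 1) c = 1) :
    ∃ b : Fin n × ℕ, IsAvailable s c b ∧ ‖c.2 b‖ ^ 2 ∈ A ∧
      ∀ b' : Fin n × ℕ, IsAvailable s c b' → ‖c.2 b'‖ ^ 2 ∈ A → b' = b := by
  rw [radialSum_indicator] at h
  obtain ⟨b, hb⟩ := encard_eq_one.1 (by exact_mod_cast h)
  have hmem : ∀ b' : Fin n × ℕ, IsAvailable s c b' ∧ ‖c.2 b'‖ ^ 2 ∈ A ↔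
      b' = b := fun b' => by
    simpa using Set.ext_iff.1 hb b'
  exact ⟨b, ((hmem b).2 rfl).1, ((hmem b).2 rfl).2, fun b' h1 h2 => (hmem b').1 ⟨h1, h2⟩⟩

theorem two_le_radialSum_indicator {A : Set ℝ} {c : (Fin n → ℕ∞) × (Fin n × ℕ → Plane)}
    (h0 : radialSum s (A.indicator 1) c ≠ 0) (h1 : radialSum s (A.indicator 1) c ≠ 1) :
    2 ≤ radialSum s (A.indicator 1) c := by
  rw [radialSum_indicator] at *
  generalize encard _ = m at *
  induction m using ENat.recTopCoe with
  | top => simp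
  | coe m =>
    simp only [ENat.toENNReal_coe, ne_eq, Nat.cast_eq_zero, Nat.cast_eq_one] at *
    exact_mod_cast (by omega : 2 ≤ m)

end Configuration

/-- The probability of an event about two independent random variables, by conditioning on the
second one. -/
theorem ProbabilityTheory.IndepFun.measure_prodMk_mem {Ω α β : Type*} [MeasurableSpace Ω]
    [MeasurableSpace α] [MeasurableSpace β] {P : Measure Ω} [IsProbabilityMeasure P] {X : Ω → α}
    {Y : Ω → β} (h : IndepFun X Y P) (hX : Measurable X) (hY : Measurable Y) {A : Set (α × β)}
    (hA : MeasurableSet A) :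
    P {ω | (X ω, Y ω) ∈ A} = ∫⁻ ω, P {ω' | (X ω', Y ω) ∈ A} ∂P := by
  have hmap := (indepFun_iff_map_prod_eq_prod_map_map hX.aemeasurable hY.aemeasurable).1 h
  have h1 : P {ω | (X ω, Y ω) ∈ A} = P.map (fun ω => (X ω, Y ω)) A :=
    (Measure.map_apply (hX.prodMk hY) hA).symm
  have := Measure.isProbabilityMeasure_map (μ := P) hX.aemeasurable
  have := Measure.isProbabilityMeasure_map (μ := P) hY.aemeasurable
  rw [h1, hmap, Measure.prod_apply_symm hA, lintegral_map (measurable_measure_prodMk_right hA) hY]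
  refine lintegral_congr fun ω => ?_
  rw [Measure.map_apply hX (measurable_prodMk_right hA)]
  rfl

/-! ### Weights that encode the conditions on a cell. -/

/-- The gain threshold contributed by an interferer at squared distance `z`, if `z` exceeds `r`,
when the squared distance to the serving base station is `τ`. -/
def farGain (T a τ r z : ℝ) : ENNReal := if r < z then ENNReal.ofReal (T * (τ / z) ^ a) else 0

@[fun_prop] theorem measurable_farGain (T a τ r : ℝ) : Measurable (farGain T a τ r) :=
  Measurable.ite measurableSet_Ioi (by fun_prop) measurable_const

theorem farGain_ne_top (T a τ r z : ℝ) : farGain T a τ r z ≠ ⊤ := by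
  unfold farGain
  split_ifs <;> simp

/-- The exponent of the mean fading of the interferers beyond `r`, together with the weight `⊤` for
points up to `t` and `c` for points between `t` and `r`. -/
def cellWeight (μ : Measure ℝ) (T a τ t r : ℝ) (c : ENNReal) (z : ℝ) : ENNReal :=
  ⊤ * (Iic t).indicator 1 z +
    (c * (Ioc t r).indicator 1 z + negLog (laplace μ (farGain T a τ r z)))

theorem measurable_negLog_laplace_farGain (μ : Measure ℝ) [IsProbabilityMeasure μ]
    (T a τ r : ℝ) : Measurable fun z => negLog (laplace μ (farGain T a τ r z)) :=
  measurable_negLog.comp ((measurable_laplace μ).comp (measurable_farGain T a τ r))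

theorem measurable_cellWeight (μ : Measure ℝ) [IsProbabilityMeasure μ] (T a τ t r : ℝ)
    (c : ENNReal) : Measurable (cellWeight μ T a τ t r c) := by
  have h1 := measurable_negLog_laplace_farGain μ T a τ r
  have h2 : Measurable ((Iic t).indicator (1 : ℝ → ENNReal)) :=
    measurable_one.indicator measurableSet_Iic
  have h3 : Measurable ((Ioc t r).indicator (1 : ℝ → ENNReal)) :=
    measurable_one.indicator measurableSet_Ioc
  exact (h2.const_mul ⊤).add ((h3.const_mul c).add h1)

theorem laplace_zero (μ : Measure ℝ) [IsProbabilityMeasure μ] : laplace μ 0 = 1 := by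
  simp [laplace]

theorem lintegral_cellWeight (μ : Measure ℝ) [IsProbabilityMeasure μ] {T a τ t r : ℝ}
    (ht : 0 ≤ t) (htr : t ≤ r) (c : ENNReal) :
    ∫⁻ z in Ioi 0, ENNReal.ofReal (1 - expNeg (cellWeight μ T a τ t r c z)) =
      ENNReal.ofReal t + (ENNReal.ofReal ((r - t) * (1 - expNeg c)) +
        ∫⁻ z in Ioi r, ENNReal.ofReal (1 - laplace μ (ENNReal.ofReal (T * (τ / z) ^ a)))) := by
  rw [← Ioc_union_Ioi_eq_Ioi ht, lintegral_union measurableSet_Ioi Ioc_disjoint_Ioi_same,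
    ← Ioc_union_Ioi_eq_Ioi htr, lintegral_union measurableSet_Ioi Ioc_disjoint_Ioi_same]
  have hneg : ∀ z, z ≤ r → negLog (laplace μ (farGain T a τ r z)) = 0 := fun z hz => by
    simp [farGain, hz.not_gt, laplace_zero, negLog]
  congr 1
  · have h : ∀ z ∈ Ioc 0 t, ENNReal.ofReal (1 - expNeg (cellWeight μ T a τ t r c z)) = 1 := by
      intro z hz
      simp [cellWeight, hz.2]
    rw [setLIntegral_congr_fun measurableSet_Ioc h]
    simp
  congr 1
  · have h : ∀ z ∈ Ioc t r, ENNReal.ofReal (1 - expNeg (cellWeight μ T a τ t r c z)) =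
        ENNReal.ofReal (1 - expNeg c) := by
      intro z hz
      simp [cellWeight, hz.1, hz.2, hneg z hz.2]
    rw [setLIntegral_congr_fun measurableSet_Ioc h, setLIntegral_const, Real.volume_Ioc, mul_comm,
      ENNReal.ofReal_mul (sub_nonneg.2 htr)]
  · refine setLIntegral_congr_fun measurableSet_Ioi fun z hz => ?_
    have hz' : r < z := hz
    have h : cellWeight μ T a τ t r c z = negLog (laplace μ (farGain T a τ r z)) := by
      simp [cellWeight, hz'.not_ge, htr.trans_lt hz']
    rw [h, expNeg_negLog (laplace_pos μ (farGain_ne_top _ _ _ _ _)) (laplace_le_one μ _), farGain,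
      if_pos hz']

/-! ### Laplace functional and conditional fading in the model. -/

namespace Downlink

variable {Ω : Type*} [MeasurableSpace Ω] (S : Downlink Ω)

/-- The numbers and the positions of the base stations. -/
def configuration (ω : Ω) : (Fin (S.K + 1) → ℕ∞) × (Fin (S.K + 1) × ℕ → Plane) :=
  (fun k => (S.bs k).num ω, fun b => (S.bs b.1).pt b.2 ω)

theorem measurable_configuration : Measurable S.configuration :=
  (measurable_pi_lambda _ fun k => (S.bs k).measurable_num).prodMk
    (measurable_pi_lambda _ fun b => (S.bs b.1).measurable_pt b.2)

theorem radialSum_configuration (W : ℝ → ENNReal) (ω : Ω) :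
    radialSum S.operators W (S.configuration ω) =
      ∑ k ∈ S.operators, (S.bs k).sum (fun x => W (‖x‖ ^ 2)) ω := by
  classical
  have h0 : radialSum S.operators W (S.configuration ω) = ∑' b : Fin (S.K + 1) × ℕ,
      (fun (k : Fin (S.K + 1)) (i : ℕ) => if k ∈ S.operators ∧ (i : ℕ∞) < (S.bs k).num ω then
        W (‖(S.bs k).pt i ω‖ ^ 2) else 0) b.1 b.2 := by
    rw [radialSum]
    congr 1 with b
    exact if_congr Iff.rfl rfl rfl
  rw [h0.trans (ENNReal.tsum_prod (f := fun (k : Fin (S.K + 1)) (i : ℕ) =>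
    if k ∈ S.operators ∧ (i : ℕ∞) < (S.bs k).num ω then W (‖(S.bs k).pt i ω‖ ^ 2) else 0)),
    tsum_fintype, ← Finset.sum_filter_add_sum_filter_not
    Finset.univ (· ∈ S.operators), Finset.filter_mem_eq_inter, Finset.univ_inter]
  rw [Finset.sum_eq_zero (s := Finset.univ.filter (· ∉ S.operators)), add_zero]
  · refine Finset.sum_congr rfl fun k hk => ?_
    simp [PointProcess.sum, hk]
  · intro k hk
    simp only [Finset.mem_filter, Finset.mem_univ, true_and] at hk
    simp [hk]

variable {S} {P : Measure Ω} [IsProbabilityMeasure P]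

/-- The Laplace functional of the enlarged set of base stations. -/
theorem IsModel.integral_expNeg_radialSum (hS : S.IsModel P) {W : ℝ → ENNReal}
    (hW : Measurable W) :
    ∫ ω, expNeg (radialSum S.operators W (S.configuration ω)) ∂P =
      expNeg (ENNReal.ofReal (Real.pi * S.netIntensity) *
        ∫⁻ z in Ioi 0, ENNReal.ofReal (1 - expNeg (W z))) := by
  simp_rw [radialSum_configuration]
  have hW' : Measurable fun x : Plane => W (‖x‖ ^ 2) := by fun_prop
  rw [PointProcess.integral_expNeg_superposition hS.poisson hS.indep_bs
    (B := fun n => Metric.closedBall 0 n)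
    (fun i j hij => Metric.closedBall_subset_closedBall (by exact_mod_cast hij))
    (fun n => Metric.isClosed_closedBall.measurableSet) (Metric.iUnion_closedBall_nat 0)
    (fun k n => ?_) S.operators hW']
  · congr 1
    have h : Measurable fun z => ENNReal.ofReal (1 - expNeg (W z)) := by fun_prop
    simp_rw [lintegral_smul_measure, smul_eq_mul]
    rw [← Finset.sum_mul, lintegral_norm_sq h, ← mul_assoc, mul_comm Real.pi, netIntensity,
      ENNReal.ofReal_mul (Finset.sum_nonneg fun k _ => hS.intensity_nonneg k),
      ENNReal.ofReal_sum_of_nonneg fun k _ => hS.intensity_nonneg k]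
  · exact ENNReal.mul_lt_top ENNReal.ofReal_lt_top measure_closedBall_lt_top

variable (S)

open Classical in
/-- The serving link would stand up to the noise and to the interference from beyond the squared
distance `r` if its base station were at squared distance `τ`. -/
def StandsUp (τ r : ℝ) (ω : Ω) : Prop :=
  ENNReal.ofReal (S.B * τ ^ (S.α / 2)) +
    ∑' b, (if S.Available ω b then farGain S.T (S.α / 2) τ r (S.dist ω b ^ 2) else 0) *
      ENNReal.ofReal (S.g b ω) < ENNReal.ofReal (S.g₀ ω)

variable {S}

theorem IsModel.isProbabilityMeasure_gainLaw (hS : S.IsModel P) :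
    IsProbabilityMeasure S.gainLaw :=
  (hS.gain (0, 0)).isProbabilityMeasure_iff.1 ‹_›

theorem IsModel.measurableSet_and_standsUp (hg₀ : Measurable S.g₀) (hg : ∀ b, Measurable (S.g b))
    {D : Set ((Fin (S.K + 1) → ℕ∞) × (Fin (S.K + 1) × ℕ → Plane))} (hD : MeasurableSet D)
    (τ r : ℝ) : MeasurableSet {ω | S.configuration ω ∈ D ∧ S.StandsUp τ r ω} := by
  classical
  refine (S.measurable_configuration hD).inter (measurableSet_lt ?_ hg₀.ennreal_ofReal)
  refine measurable_const.add (Measurable.tsum fun b => Measurable.mul ?_ (hg b).ennreal_ofReal)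
  refine Measurable.ite ?_ ?_ measurable_const
  · exact S.measurable_configuration (measurableSet_available S.operators b)
  · exact (measurable_farGain _ _ _ _).comp (((S.bs b.1).measurable_pt b.2).norm.pow_const 2)

/-- Conditioning on the configuration freezes the positions, and `measureReal_interference_lt`
evaluates the fading. The product of Laplace transforms is written as a radial sum, so that it can
be merged with void and counting weights. -/
theorem IsModel.measureReal_and_standsUp (hS : S.IsModel P) (hg₀ : Measurable S.g₀)
    (hg : ∀ b, Measurable (S.g b))
    {D : Set ((Fin (S.K + 1) → ℕ∞) × (Fin (S.K + 1) × ℕ → Plane))} (hD : MeasurableSet D)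
    (τ r : ℝ) :
    P.real {ω | S.configuration ω ∈ D ∧ S.StandsUp τ r ω} =
      ∫ ω, {ω | S.configuration ω ∈ D}.indicator (fun ω =>
        expNeg (ENNReal.ofReal (S.B * τ ^ (S.α / 2))) *
        expNeg (radialSum S.operators (fun z => negLog (laplace S.gainLaw
          (farGain S.T (S.α / 2) τ r z))) (S.configuration ω))) ω ∂P := by
  classical
  have := hS.isProbabilityMeasure_gainLaw
  let A : Set ((ℝ × (Fin (S.K + 1) × ℕ → ℝ)) ×
      ((Fin (S.K + 1) → ℕ∞) × (Fin (S.K + 1) × ℕ → Plane))) :=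
    {q | q.2 ∈ D ∧ ENNReal.ofReal (S.B * τ ^ (S.α / 2)) +
      ∑' b : Fin (S.K + 1) × ℕ, (if IsAvailable S.operators q.2 b then
        farGain S.T (S.α / 2) τ r (‖q.2.2 b‖ ^ 2) else 0) * ENNReal.ofReal (q.1.2 b) <
        ENNReal.ofReal q.1.1}
  have hA : MeasurableSet A := by
    suffices hI : Measurable fun q : (ℝ × (Fin (S.K + 1) × ℕ → ℝ)) ×
        ((Fin (S.K + 1) → ℕ∞) × (Fin (S.K + 1) × ℕ → Plane)) =>
        ENNReal.ofReal (S.B * τ ^ (S.α / 2)) +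
        ∑' b : Fin (S.K + 1) × ℕ, (if IsAvailable S.operators q.2 b then
        farGain S.T (S.α / 2) τ r (‖q.2.2 b‖ ^ 2) else 0) * ENNReal.ofReal (q.1.2 b) by
      exact (measurable_snd hD).inter (measurableSet_lt hI measurable_fst.fst.ennreal_ofReal)
    refine Measurable.const_add (Measurable.tsum fun b => ?_) _
    refine Measurable.mul ?_ (by fun_prop)
    refine Measurable.ite ?_ ?_ measurable_const
    · exact measurable_snd (measurableSet_available S.operators b)
    · have hd : Measurable fun q : (ℝ × (Fin (S.K + 1) × ℕ → ℝ)) ×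
          ((Fin (S.K + 1) → ℕ∞) × (Fin (S.K + 1) × ℕ → Plane)) => ‖q.2.2 b‖ ^ 2 := by fun_prop
      exact (measurable_farGain _ _ _ _).comp hd
  have h1 := hS.indep_gain_bs.measure_prodMk_mem
    (hg₀.prodMk (measurable_pi_lambda _ hg)) S.measurable_configuration hA
  have h2 : ∀ ω, P {ω' | ((S.g₀ ω', fun b => S.g b ω'), S.configuration ω) ∈ A} =
      ENNReal.ofReal ({ω | S.configuration ω ∈ D}.indicator (fun ω =>
        expNeg (ENNReal.ofReal (S.B * τ ^ (S.α / 2))) *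
        expNeg (radialSum S.operators (fun z => negLog (laplace S.gainLaw
          (farGain S.T (S.α / 2) τ r z))) (S.configuration ω))) ω) := by
    intro ω
    by_cases hω : S.configuration ω ∈ D
    · have hω' : ω ∈ {ω | S.configuration ω ∈ D} := hω
      rw [indicator_of_mem hω', ← ofReal_measureReal]
      congr 1
      have h3 := measureReal_interference_lt hg₀ hg hS.rayleigh hS.gain hS.indep_gain
        (ENNReal.ofReal (S.B * τ ^ (S.α / 2)))
        (a := fun b => if S.Available ω b then farGain S.T (S.α / 2) τ r (S.dist ω b ^ 2) else 0)
        (fun b => by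
          split_ifs
          exacts [farGain_ne_top _ _ _ _ _, ENNReal.zero_ne_top])
      have h4 : radialSum S.operators (fun z => negLog (laplace S.gainLaw
          (farGain S.T (S.α / 2) τ r z))) (S.configuration ω) =
          ∑' b, negLog (laplace S.gainLaw (if S.Available ω b then
            farGain S.T (S.α / 2) τ r (S.dist ω b ^ 2) else 0)) := by
        rw [radialSum]
        congr 1 with b
        by_cases hb : S.Available ω b
        · have hb' : IsAvailable S.operators (S.configuration ω) b := hb
          rw [if_pos hb, if_pos hb']
          rfl
        · have hb' : ¬ IsAvailable S.operators (S.configuration ω) b := hb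
          rw [if_neg hb, if_neg hb', laplace_zero]
          simp [negLog]
      rw [h4, ← h3]
      congr 1
      ext ω'
      exact ⟨fun h => h.2, fun h => ⟨hω, h⟩⟩
    · have hω' : ω ∉ {ω | S.configuration ω ∈ D} := hω
      rw [indicator_of_notMem hω', ENNReal.ofReal_zero]
      have : {ω' | ((S.g₀ ω', fun b => S.g b ω'), S.configuration ω) ∈ A} = ∅ :=
        eq_empty_of_forall_notMem fun ω' h => hω h.1
      rw [this, measure_empty]
  have h5 : P {ω | S.configuration ω ∈ D ∧ S.StandsUp τ r ω} =
      P {ω | ((S.g₀ ω, fun b => S.g b ω), S.configuration ω) ∈ A} := by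
    rfl
  rw [measureReal_def, h5]
  refine (congrArg ENNReal.toReal (h1.trans (lintegral_congr h2))).trans ?_
  rw [integral_eq_lintegral_of_nonneg_ae]
  · exact .of_forall fun ω => indicator_nonneg
      (fun ω _ => mul_nonneg (expNeg_nonneg _) (expNeg_nonneg _)) ω
  · refine (Measurable.indicator ?_ (S.measurable_configuration hD)).aestronglyMeasurable
    exact measurable_const.mul (measurable_expNeg.comp ((measurable_radialSum _
      (measurable_negLog_laplace_farGain _ _ _ _ _)).comp S.measurable_configuration))

end Downlink

theorem expNeg_top_mul (x : ENNReal) : expNeg (⊤ * x) = if x = 0 then 1 else 0 := by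
  split_ifs with h
  · simp [h]
  · simp [ENNReal.top_mul h]

/-! ### The coefficient β and the probabilities of the cells. -/

namespace Downlink

variable {Ω : Type*} [MeasurableSpace Ω] {S : Downlink Ω} {P : Measure Ω}

theorem IsModel.half_α (hS : S.IsModel P) : 1 < S.α / 2 := by
  linarith [hS.two_lt_α]

theorem IsModel.B_nonneg (hS : S.IsModel P) : 0 ≤ S.B :=
  div_nonneg (mul_nonneg hS.T_pos.le (sq_nonneg _)) hS.p_pos.le

theorem IsModel.intensity_pos (hS : S.IsModel P) : 0 < Real.pi * S.netIntensity :=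
  mul_pos Real.pi_pos hS.netIntensity_pos

theorem IsModel.integrable_rpow_gainLaw (hS : S.IsModel P) :
    Integrable (fun x : ℝ => x ^ (1 / (S.α / 2))) S.gainLaw := by
  rw [one_div_div]
  exact hS.gain_moment

theorem IsModel.betaIntegrand_mul (hS : S.IsModel P) {x : ℝ} (hx : 0 < x) :
    S.betaIntegrand (S.p * x) =
      (S.p / S.T) ^ (2 / S.α) / (2 / S.α) * (interferenceArea (S.α / 2) (S.T * x) + 1) := by
  have hp := hS.p_pos
  have hT := hS.T_pos
  have hα := hS.two_lt_α
  rw [interferenceArea_add_one (by linarith) (by positivity), betaIntegrand, one_div_div]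
  have h1 : S.T * (S.p * x) / S.p = S.T * x := by field_simp
  have h2 : (S.p * x) ^ (2 / S.α) = (S.p / S.T) ^ (2 / S.α) * (S.T * x) ^ (2 / S.α) := by
    rw [← Real.mul_rpow (by positivity) (by positivity)]
    congr 1
    field_simp
  rw [h1, h2]
  have h3 : 2 / S.α ≠ 0 := by positivity
  field_simp

theorem IsModel.betaIntegrand_ae (hS : S.IsModel P) :
    (fun x => S.betaIntegrand (S.p * x)) =ᵐ[S.gainLaw] fun x =>
      (S.p / S.T) ^ (2 / S.α) / (2 / S.α) * (interferenceArea (S.α / 2) (S.T * x) + 1) :=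
  hS.gain_pos.mono fun _ hx => hS.betaIntegrand_mul hx

variable [IsProbabilityMeasure P]

theorem IsModel.integrable_betaIntegrand (hS : S.IsModel P) :
    Integrable S.betaIntegrand S.powerLaw := by
  have := hS.isProbabilityMeasure_gainLaw
  rw [powerLaw, (measurableEmbedding_mulLeft₀ hS.p_pos.ne').integrable_map_iff]
  refine Integrable.congr ?_ hS.betaIntegrand_ae.symm
  exact ((integrable_interferenceArea hS.half_α hS.T_pos hS.gain_pos
    hS.integrable_rpow_gainLaw).add (integrable_const 1)).const_mul _

/-- The transmit power cancels between the prefactor, the threshold T/p and the total gain p g; the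
rest is `interferenceArea_add_one` under the mean. -/
theorem IsModel.beta_eq (hS : S.IsModel P) :
    S.beta = 1 + ∫ x, interferenceArea (S.α / 2) (S.T * x) ∂S.gainLaw := by
  have := hS.isProbabilityMeasure_gainLaw
  have hp := hS.p_pos
  have hT := hS.T_pos
  have hα := hS.two_lt_α
  have hi := integrable_interferenceArea hS.half_α hS.T_pos hS.gain_pos
    hS.integrable_rpow_gainLaw
  have h1 : (S.T / S.p) ^ (2 / S.α) * (S.p / S.T) ^ (2 / S.α) = 1 := by
    rw [← Real.mul_rpow (by positivity) (by positivity), div_mul_div_cancel₀ hp.ne',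
      div_self hT.ne', Real.one_rpow]
  rw [beta, powerLaw, (measurableEmbedding_mulLeft₀ hS.p_pos.ne').integral_map,
    integral_congr_ae hS.betaIntegrand_ae, integral_const_mul,
    integral_add hi (integrable_const 1)]
  simp only [integral_const, probReal_univ, smul_eq_mul, mul_one]
  calc _ = (S.T / S.p) ^ (2 / S.α) * (S.p / S.T) ^ (2 / S.α) * ((2 / S.α) / (2 / S.α)) *
        (∫ x, interferenceArea (S.α / 2) (S.T * x) ∂S.gainLaw + 1) := by ring
    _ = _ := by rw [h1, div_self (by positivity)]; ring

theorem IsModel.one_le_beta (hS : S.IsModel P) : 1 ≤ S.beta := by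
  rw [hS.beta_eq, le_add_iff_nonneg_right]
  refine integral_nonneg_of_ae (hS.gain_pos.mono fun x hx => ?_)
  exact interferenceArea_nonneg hS.half_α (mul_pos hS.T_pos hx)

theorem IsModel.lintegral_one_sub_laplace (hS : S.IsModel P) {t : ℝ} (ht : 0 < t) :
    ∫⁻ y in Ioi t, ENNReal.ofReal
      (1 - laplace S.gainLaw (ENNReal.ofReal (S.T * (t / y) ^ (S.α / 2)))) =
      ENNReal.ofReal (t * (S.beta - 1)) := by
  have := hS.isProbabilityMeasure_gainLaw
  rw [hS.beta_eq, add_sub_cancel_left]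
  exact _root_.lintegral_one_sub_laplace hS.half_α hS.T_pos hS.gain_pos
    hS.integrable_rpow_gainLaw ht

variable (S) in
/-- The mean fading of the interferers beyond `r`, when the serving base station is at squared
distance `τ`. -/
def farFading (τ r : ℝ) : ℝ :=
  expNeg (ENNReal.ofReal (Real.pi * S.netIntensity) * ∫⁻ z in Ioi r, ENNReal.ofReal
    (1 - laplace S.gainLaw (ENNReal.ofReal (S.T * (τ / z) ^ (S.α / 2)))))

theorem IsModel.integral_expNeg_cellWeight (hS : S.IsModel P) {τ t r : ℝ} (ht : 0 ≤ t)
    (htr : t ≤ r) (c : ENNReal) :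
    ∫ ω, expNeg (radialSum S.operators (cellWeight S.gainLaw S.T (S.α / 2) τ t r c)
      (S.configuration ω)) ∂P =
      Real.exp (-(Real.pi * S.netIntensity * t)) *
        (Real.exp (-(Real.pi * S.netIntensity * ((r - t) * (1 - expNeg c)))) *
          S.farFading τ r) := by
  have := hS.isProbabilityMeasure_gainLaw
  have hρ := hS.intensity_pos.le
  have h1 : 0 ≤ (r - t) * (1 - expNeg c) :=
    mul_nonneg (sub_nonneg.2 htr) (sub_nonneg.2 (expNeg_le_one c))
  rw [hS.integral_expNeg_radialSum (measurable_cellWeight _ _ _ _ _ _ _),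
    lintegral_cellWeight _ ht htr, mul_add, mul_add, expNeg_add, expNeg_add,
    ← ENNReal.ofReal_mul hρ, ← ENNReal.ofReal_mul hρ, expNeg_ofReal (mul_nonneg hρ ht),
    expNeg_ofReal (mul_nonneg hρ h1), farFading]

theorem IsModel.farFading_self (hS : S.IsModel P) {r : ℝ} (hr : 0 < r) :
    S.farFading r r = Real.exp (-(Real.pi * S.netIntensity * (r * (S.beta - 1)))) := by
  rw [farFading, hS.lintegral_one_sub_laplace hr, ← ENNReal.ofReal_mul hS.intensity_pos.le,
    expNeg_ofReal]
  exact mul_nonneg hS.intensity_pos.le (mul_nonneg hr.le (sub_nonneg.2 hS.one_le_beta))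

/-- Interference from between t and r is missing in `farFading t r`. Restoring it integrates a
function bounded by 1 over a length r - t, which costs at most the factor on the left. -/
theorem IsModel.farFading_le (hS : S.IsModel P) {t r : ℝ} (ht : 0 ≤ t) (htr : t ≤ r) :
    Real.exp (-(Real.pi * S.netIntensity * (r - t))) * S.farFading t r ≤
      Real.exp (-(Real.pi * S.netIntensity * (t * (S.beta - 1)))) := by
  have hρ := hS.intensity_pos.le
  have hβ := hS.one_le_beta
  rw [farFading, ← expNeg_ofReal (mul_nonneg hρ (sub_nonneg.2 htr)), ENNReal.ofReal_mul hρ,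
    ← expNeg_add, ← mul_add,
    ← expNeg_ofReal (mul_nonneg hρ (mul_nonneg ht (sub_nonneg.2 hβ))), ENNReal.ofReal_mul hρ]
  refine expNeg_antitone ?_
  gcongr
  rcases ht.eq_or_lt with rfl | ht
  · simp
  rw [← hS.lintegral_one_sub_laplace ht, ← Ioc_union_Ioi_eq_Ioi htr,
    lintegral_union measurableSet_Ioi Ioc_disjoint_Ioi_same]
  gcongr
  calc (∫⁻ y in Ioc t r, ENNReal.ofReal
        (1 - laplace S.gainLaw (ENNReal.ofReal (S.T * (t / y) ^ (S.α / 2)))))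
      ≤ ∫⁻ y in Ioc t r, 1 := by
        refine lintegral_mono fun y => ?_
        rw [← ENNReal.ofReal_one]
        exact ENNReal.ofReal_le_ofReal
          (sub_le_self _ (integral_nonneg fun _ => expNeg_nonneg _))
    _ = ENNReal.ofReal (r - t) := by simp

section Cells

variable (S) in
/-- The configurations without base stations up to squared distance `t` and with a number in `N` of
base stations between `t` and `r`. -/
def cellEvent (t r : ℝ) (N : Set ENNReal) :
    Set ((Fin (S.K + 1) → ℕ∞) × (Fin (S.K + 1) × ℕ → Plane)) :=
  {c | radialSum S.operators ((Iic t).indicator 1) c = 0 ∧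
    radialSum S.operators ((Ioc t r).indicator 1) c ∈ N}

theorem measurableSet_cellEvent (t r : ℝ) {N : Set ENNReal} (hN : MeasurableSet N) :
    MeasurableSet (S.cellEvent t r N) :=
  (measurable_radialSum _ (measurable_one.indicator measurableSet_Iic)
    (measurableSet_singleton 0)).inter
    (measurable_radialSum _ (measurable_one.indicator measurableSet_Ioc) hN)

variable (S) in
-- The three weights separate: ⊤ gives the indicator of a void up to t, c gives e^(-c) to the power
-- of the number of points in the cell, and the last one gives the fading.
theorem expNeg_radialSum_cellWeight (τ t r : ℝ) (c : ENNReal)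
    (x : (Fin (S.K + 1) → ℕ∞) × (Fin (S.K + 1) × ℕ → Plane)) :
    expNeg (radialSum S.operators (cellWeight S.gainLaw S.T (S.α / 2) τ t r c) x) =
      (if radialSum S.operators ((Iic t).indicator 1) x = 0 then 1 else 0) *
      (expNeg (c * radialSum S.operators ((Ioc t r).indicator 1) x) *
      expNeg (radialSum S.operators (fun z => negLog (laplace S.gainLaw
        (farGain S.T (S.α / 2) τ r z))) x)) := by
  unfold cellWeight
  rw [radialSum_add, radialSum_add, radialSum_const_mul, radialSum_const_mul, expNeg_add,
    expNeg_add, expNeg_top_mul]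

theorem IsModel.integrable_expNeg_cellWeight (hS : S.IsModel P) (τ t r : ℝ) (c : ENNReal) :
    Integrable (fun ω => expNeg (radialSum S.operators
      (cellWeight S.gainLaw S.T (S.α / 2) τ t r c) (S.configuration ω))) P := by
  have := hS.isProbabilityMeasure_gainLaw
  exact integrable_expNeg ((measurable_radialSum _ (measurable_cellWeight _ _ _ _ _ _ _)).comp
    S.measurable_configuration).aemeasurable

theorem IsModel.measureReal_upper_cell (hS : S.IsModel P) (hg₀ : Measurable S.g₀)
    (hg : ∀ b, Measurable (S.g b)) {t r : ℝ} (ht : 0 ≤ t) (htr : t ≤ r) :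
    P.real {ω | S.configuration ω ∈ S.cellEvent t r {0}ᶜ ∧ S.StandsUp t r ω} ≤
      (Real.exp (Real.pi * S.netIntensity * (r - t)) - 1) *
        Real.exp (-(Real.pi * S.netIntensity * S.beta * t + S.B * t ^ (S.α / 2))) := by
  rw [hS.measureReal_and_standsUp hg₀ hg
    (measurableSet_cellEvent t r (measurableSet_singleton 0).compl)]
  have hB : 0 ≤ S.B * t ^ (S.α / 2) := mul_nonneg hS.B_nonneg (by positivity)
  rw [expNeg_ofReal hB]
  -- With N points in the cell, the indicator of N ≥ 1 is 1 - 0^N, the difference between the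
  -- weights c = 0 and c = ⊤.
  have h1 : ∀ ω, {ω | S.configuration ω ∈ S.cellEvent t r {0}ᶜ}.indicator (fun ω =>
      Real.exp (-(S.B * t ^ (S.α / 2))) *
      expNeg (radialSum S.operators (fun z => negLog (laplace S.gainLaw
        (farGain S.T (S.α / 2) t r z))) (S.configuration ω))) ω =
      Real.exp (-(S.B * t ^ (S.α / 2))) *
      (expNeg (radialSum S.operators (cellWeight S.gainLaw S.T (S.α / 2) t t r 0)
        (S.configuration ω)) -
      expNeg (radialSum S.operators (cellWeight S.gainLaw S.T (S.α / 2) t t r ⊤)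
        (S.configuration ω))) := by
    intro ω
    rw [expNeg_radialSum_cellWeight, expNeg_radialSum_cellWeight, expNeg_top_mul, zero_mul,
      expNeg_zero]
    by_cases h0 : radialSum S.operators ((Iic t).indicator 1) (S.configuration ω) = 0 <;>
    by_cases h1 : radialSum S.operators ((Ioc t r).indicator 1) (S.configuration ω) = 0 <;>
    simp [indicator, cellEvent, h0, h1]
  simp_rw [h1]
  rw [integral_const_mul, integral_sub (hS.integrable_expNeg_cellWeight _ _ _ _)
    (hS.integrable_expNeg_cellWeight _ _ _ _), hS.integral_expNeg_cellWeight ht htr,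
    hS.integral_expNeg_cellWeight ht htr, expNeg_zero, expNeg_top]
  have h2 := hS.farFading_le ht htr
  set ρ := Real.pi * S.netIntensity
  have hρ : 0 < ρ := hS.intensity_pos
  have h3 : 0 ≤ Real.exp (ρ * (r - t)) - 1 :=
    sub_nonneg.2 (Real.one_le_exp (mul_nonneg hρ.le (sub_nonneg.2 htr)))
  have h4 : Real.exp (ρ * (r - t)) * Real.exp (-(ρ * (r - t))) = 1 := by
    rw [← Real.exp_add, add_neg_cancel, Real.exp_zero]
  have h5 : Real.exp (-(ρ * S.beta * t + S.B * t ^ (S.α / 2))) =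
      Real.exp (-(S.B * t ^ (S.α / 2))) * (Real.exp (-(ρ * t)) *
        Real.exp (-(ρ * (t * (S.beta - 1))))) := by
    rw [← Real.exp_add, ← Real.exp_add]; ring_nf
  simp only [sub_self, sub_zero, mul_zero, neg_zero, Real.exp_zero, mul_one, one_mul]
  rw [h5]
  -- With m = ρ(r - t), 1 - e^(-m) = (e^m - 1) e^(-m); the factor e^(-m) is the one that
  -- `farFading_le` absorbs.
  calc _ = (Real.exp (ρ * (r - t)) - 1) * (Real.exp (-(S.B * t ^ (S.α / 2))) *
        (Real.exp (-(ρ * t)) * (Real.exp (-(ρ * (r - t))) * S.farFading t r))) := by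
        linear_combination (-(Real.exp (-(S.B * t ^ (S.α / 2)))) * Real.exp (-(ρ * t)) *
          S.farFading t r) * h4
    _ ≤ _ := by gcongr

theorem IsModel.le_measureReal_lower_cell (hS : S.IsModel P) (hg₀ : Measurable S.g₀)
    (hg : ∀ b, Measurable (S.g b)) {t r θ : ℝ} (ht : 0 ≤ t) (htr : t < r) (hθ0 : 0 < θ)
    (hθ1 : θ ≤ 1) :
    (Real.pi * S.netIntensity * (r - t) -
        θ * (Real.exp (Real.pi * S.netIntensity * (r - t)) - 1)) *
        Real.exp (-(Real.pi * S.netIntensity * S.beta * r + S.B * r ^ (S.α / 2))) ≤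
      P.real {ω | S.configuration ω ∈ S.cellEvent t r {1} ∧ S.StandsUp r r ω} := by
  rw [hS.measureReal_and_standsUp hg₀ hg
    (measurableSet_cellEvent t r (measurableSet_singleton 1))]
  have hr : 0 < r := ht.trans_lt htr
  have hB : 0 ≤ S.B * r ^ (S.α / 2) := mul_nonneg hS.B_nonneg (by positivity)
  rw [expNeg_ofReal hB]
  have hprob := hS.isProbabilityMeasure_gainLaw
  let Z : ENNReal → Ω → ℝ := fun c ω => expNeg (radialSum S.operators
    (cellWeight S.gainLaw S.T (S.α / 2) r t r c) (S.configuration ω))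
  have hZ : ∀ c, Integrable (Z c) P := fun c => hS.integrable_expNeg_cellWeight _ _ _ _
  -- With N points in the cell, 1{N = 1} ≥ (θ^N - 0^N)/θ - θ(1 - 0^N): the right side is 0 for N =
  -- 0, 1 - θ for N = 1, and at most 0 for N ≥ 2. Its terms are accessible to the Laplace
  -- functional, through the weights c = negLog θ, ⊤ and 0.
  have h1 : ∀ ω, Real.exp (-(S.B * r ^ (S.α / 2))) *
      ((Z (negLog θ) ω - Z ⊤ ω) / θ - θ * (Z 0 ω - Z ⊤ ω)) ≤
      {ω | S.configuration ω ∈ S.cellEvent t r {1}}.indicator (fun ω =>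
      Real.exp (-(S.B * r ^ (S.α / 2))) *
      expNeg (radialSum S.operators (fun z => negLog (laplace S.gainLaw
        (farGain S.T (S.α / 2) r r z))) (S.configuration ω))) ω := by
    intro ω
    simp only [Z]
    rw [expNeg_radialSum_cellWeight, expNeg_radialSum_cellWeight, expNeg_radialSum_cellWeight,
      expNeg_top_mul, zero_mul, expNeg_zero]
    generalize hY : expNeg (radialSum S.operators (fun z => negLog (laplace S.gainLaw
        (farGain S.T (S.α / 2) r r z))) (S.configuration ω)) = Y
    have hY0 : 0 ≤ Y := hY ▸ expNeg_nonneg _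
    by_cases h0 : radialSum S.operators ((Iic t).indicator 1) (S.configuration ω) = 0
    swap
    · simp [indicator, cellEvent, h0]
    by_cases hN0 : radialSum S.operators ((Ioc t r).indicator 1) (S.configuration ω) = 0
    · simp [indicator, cellEvent, h0, hN0]
    by_cases hN1 : radialSum S.operators ((Ioc t r).indicator 1) (S.configuration ω) = 1
    · simp only [indicator, cellEvent, h0, hN1, mem_ofPred_eq, mem_singleton_iff, and_self,
        if_true, mul_one, one_mul, one_ne_zero, if_false, zero_mul, sub_zero,
        expNeg_negLog hθ0 hθ1]
      rw [mul_div_cancel_left₀ _ hθ0.ne']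
      have : 0 ≤ θ * Y := by positivity
      gcongr
      linarith
    · have hN2 := two_le_radialSum_indicator _ hN0 hN1
      simp only [indicator, cellEvent, h0, hN0, hN1, mem_ofPred_eq, mem_singleton_iff, and_false,
        if_true, one_mul, if_false, zero_mul, mul_zero, sub_zero]
      have h2 : expNeg (negLog θ * radialSum S.operators ((Ioc t r).indicator 1)
          (S.configuration ω)) ≤ θ * θ := by
        rw [← expNeg_negLog hθ0 hθ1, ← expNeg_add, ← two_mul, mul_comm 2,
          expNeg_negLog hθ0 hθ1]
        exact expNeg_antitone (by gcongr)
      refine mul_nonpos_of_nonneg_of_nonpos (Real.exp_pos _).le ?_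
      rw [sub_nonpos, div_le_iff₀ hθ0]
      calc _ ≤ θ * θ * Y := by gcongr
        _ = _ := by ring
  have hi1 : Integrable (fun ω => (Z (negLog θ) ω - Z ⊤ ω) / θ) P :=
    ((hZ (negLog θ)).sub (hZ ⊤)).div_const θ
  have hi2 : Integrable (fun ω => θ * (Z 0 ω - Z ⊤ ω)) P := ((hZ 0).sub (hZ ⊤)).const_mul θ
  have hi3 : Integrable (fun ω => Real.exp (-(S.B * r ^ (S.α / 2))) *
      expNeg (radialSum S.operators (fun z => negLog (laplace S.gainLaw
        (farGain S.T (S.α / 2) r r z))) (S.configuration ω))) P :=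
    (integrable_expNeg ((measurable_radialSum _
      (measurable_negLog_laplace_farGain _ _ _ _ _)).comp
      S.measurable_configuration).aemeasurable).const_mul _
  refine le_trans ?_ (integral_mono ((hi1.sub hi2).const_mul _) (hi3.indicator
    (S.measurable_configuration (measurableSet_cellEvent t r (measurableSet_singleton 1)))) h1)
  rw [integral_const_mul, integral_sub' hi1 hi2, integral_div, integral_const_mul,
    integral_sub (hZ _) (hZ _), integral_sub (hZ _) (hZ _)]
  simp only [Z]
  rw [hS.integral_expNeg_cellWeight ht htr.le, hS.integral_expNeg_cellWeight ht htr.le,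
    hS.integral_expNeg_cellWeight ht htr.le, expNeg_zero, expNeg_top, expNeg_negLog hθ0 hθ1,
    hS.farFading_self hr]
  generalize hm : Real.pi * S.netIntensity * (r - t) = m
  have e1 : Real.pi * S.netIntensity * ((r - t) * (1 - θ)) = m - m * θ := by rw [← hm]; ring
  have e2 : Real.pi * S.netIntensity * ((r - t) * (1 - 0)) = m := by rw [← hm]; ring
  have e3 : Real.pi * S.netIntensity * ((r - t) * (1 - 1)) = 0 := by ring
  have e4 : Real.exp (-(m - m * θ)) = Real.exp (-m) * Real.exp (m * θ) := by
    rw [← Real.exp_add]; ring_nf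
  have e5 : Real.exp (-(Real.pi * S.netIntensity * S.beta * r + S.B * r ^ (S.α / 2))) =
      Real.exp (-(S.B * r ^ (S.α / 2))) * (Real.exp (-(Real.pi * S.netIntensity * t)) *
        (Real.exp (-m) * Real.exp (-(Real.pi * S.netIntensity * (r * (S.beta - 1)))))) := by
    rw [← Real.exp_add, ← Real.exp_add, ← Real.exp_add, ← hm]; ring_nf
  have e6 : Real.exp (-m) * Real.exp m = 1 := by
    rw [← Real.exp_add, neg_add_cancel, Real.exp_zero]
  have e7 : m ≤ (Real.exp (m * θ) - 1) / θ := by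
    rw [le_div_iff₀ hθ0]
    linarith [Real.add_one_le_exp (m * θ)]
  rw [e1, e2, e3, e4, e5, neg_zero, Real.exp_zero]
  have hE := Real.exp_pos (-(S.B * r ^ (S.α / 2)))
  have hF := Real.exp_pos (-(Real.pi * S.netIntensity * t))
  have hH := Real.exp_pos (-(Real.pi * S.netIntensity * (r * (S.beta - 1))))
  generalize Real.exp (-(S.B * r ^ (S.α / 2))) = E at *
  generalize Real.exp (-(Real.pi * S.netIntensity * t)) = F at *
  generalize Real.exp (-(Real.pi * S.netIntensity * (r * (S.beta - 1)))) = H at *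
  calc (m - θ * (Real.exp m - 1)) * (E * (F * (Real.exp (-m) * H)))
      ≤ ((Real.exp (m * θ) - 1) / θ - θ * (Real.exp m - 1)) *
        (E * (F * (Real.exp (-m) * H))) := by gcongr
    _ = _ := by linear_combination (-θ * E * F * H) * e6

end Cells

end Downlink

/-! ### From the SINR condition to the cells. -/

theorem ENNReal.lt_mul_div_iff {a g v x : ENNReal} (ha0 : a ≠ 0) (ha : a ≠ ⊤) (hv0 : v ≠ 0)
    (hv : v ≠ ⊤) : a < g * v / x ↔ a / v * x < g := by
  rw [ENNReal.lt_div_iff_mul_lt (Or.inr ha) (Or.inr ha0), ← ENNReal.div_lt_iff (Or.inl hv0)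
    (Or.inl hv), ENNReal.mul_div_right_comm]

namespace Downlink

variable {Ω : Type*} [MeasurableSpace Ω] {S : Downlink Ω} {P : Measure Ω}

theorem dist_nonneg (ω : Ω) (b : Fin (S.K + 1) × ℕ) : 0 ≤ S.dist ω b := norm_nonneg _

theorem sq_rpow_half_α {x : ℝ} (hx : 0 ≤ x) : (x ^ 2) ^ (S.α / 2) = x ^ S.α := by
  rw [← Real.rpow_natCast_mul hx]
  congr 1
  push_cast
  ring

open Classical in
-- Dividing by the useful power per unit gain isolates g₀. The transmit power cancels from the
-- interference and survives only in B.
theorem IsModel.lt_sinr_iff (hS : S.IsModel P) {ω : Ω} {b : Fin (S.K + 1) × ℕ}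
    (hact : ∀ b, S.Available ω b → S.active b ω = true) (hd : 0 < S.dist ω b) :
    ENNReal.ofReal S.T < S.sinr ω b ↔
      ENNReal.ofReal (S.B * (S.dist ω b ^ 2) ^ (S.α / 2)) +
        ∑' b', (if S.Available ω b' ∧ b' ≠ b then
          ENNReal.ofReal (S.T * (S.dist ω b ^ 2 / S.dist ω b' ^ 2) ^ (S.α / 2)) else 0) *
          ENNReal.ofReal (S.g b' ω) < ENNReal.ofReal (S.g₀ ω) := by
  have hp := hS.p_pos
  have hT := hS.T_pos
  have hv : 0 < S.dist ω b ^ (-S.α) * S.p := by positivity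
  have hTv : S.T / (S.dist ω b ^ (-S.α) * S.p) = S.T * S.dist ω b ^ S.α / S.p := by
    rw [Real.rpow_neg hd.le]
    field_simp
  rw [sinr, mul_assoc, ENNReal.ofReal_mul' hv.le, ENNReal.lt_mul_div_iff
    (ENNReal.ofReal_pos.2 hT).ne' ENNReal.ofReal_ne_top (ENNReal.ofReal_pos.2 hv).ne'
    ENNReal.ofReal_ne_top, ← ENNReal.ofReal_div_of_pos hv, hTv, mul_add, add_comm,
    ← ENNReal.ofReal_mul (by positivity), interference, ← ENNReal.tsum_mul_left]
  have h1 : S.T * S.dist ω b ^ S.α / S.p * S.σ ^ 2 = S.B * (S.dist ω b ^ 2) ^ (S.α / 2) := by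
    rw [sq_rpow_half_α hd.le, B]
    ring
  rw [h1]
  refine Iff.of_eq (congrArg (fun x => _ + x < _) (tsum_congr fun b' => ?_))
  by_cases h : S.Available ω b' ∧ b' ≠ b
  · rw [if_pos h, if_pos ⟨h.1, h.2, hact b' h.1⟩, ← ENNReal.ofReal_mul (by positivity),
      ← ENNReal.ofReal_mul (by positivity)]
    congr 1
    rw [← div_pow, sq_rpow_half_α (div_nonneg hd.le (dist_nonneg ω b')),
      Real.div_rpow hd.le (dist_nonneg ω b'), Real.rpow_neg (dist_nonneg ω b')]
    field_simp
  · rw [if_neg h, if_neg fun h' => h ⟨h'.1, h'.2.1⟩, mul_zero, zero_mul]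

theorem IsModel.dist_pos_of_lt_sinr (hS : S.IsModel P) {ω : Ω} {b : Fin (S.K + 1) × ℕ}
    (h : ENNReal.ofReal S.T < S.sinr ω b) : 0 < S.dist ω b := by
  refine (dist_nonneg ω b).lt_of_ne' fun h0 => ?_
  have hα := hS.two_lt_α
  -- By convention 0^(-α) = 0, so a server at the origin has SINR 0 and never covers.
  rw [sinr, h0, Real.zero_rpow (by linarith)] at h
  simp at h

theorem mem_cellEvent_iff {t r : ℝ} {N : Set ENNReal} {ω : Ω} :
    S.configuration ω ∈ S.cellEvent t r N ↔
      (∀ b, S.Available ω b → t < S.dist ω b ^ 2) ∧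
        radialSum S.operators ((Ioc t r).indicator 1) (S.configuration ω) ∈ N := by
  refine and_congr_left' ((radialSum_indicator_eq_zero _).trans ?_)
  exact forall_congr' fun b => imp_congr Iff.rfl (by rw [mem_Iic, not_le]; rfl)

/-- The cell is the one containing the server. Moving the server to the inner end and ignoring
interferers of its own cell only helps the link. -/
theorem IsModel.exists_upper_cell (hS : S.IsModel P) {ω : Ω}
    (hact : ∀ b, S.Available ω b → S.active b ω = true) {d : ℝ} (hd : 0 < d)
    (h : ∃ b, S.IsServing ω b ∧ ENNReal.ofReal S.T < S.sinr ω b) :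
    ∃ j : ℕ, S.configuration ω ∈ S.cellEvent (j * d) ((j + 1) * d) {0}ᶜ ∧
      S.StandsUp (j * d) ((j + 1) * d) ω := by
  classical
  obtain ⟨b, ⟨hb, hmin⟩, hsinr⟩ := h
  have hdb := hS.dist_pos_of_lt_sinr hsinr
  have hα := hS.two_lt_α
  have hT := hS.T_pos
  have hB := hS.B_nonneg
  have hz : S.dist ω b ^ 2 ∈ Ioi (0 : ℝ) := by
    simp only [mem_Ioi]; positivity
  rw [Ioi_zero_eq_iUnion_Ioc hd] at hz
  obtain ⟨j, hj⟩ := mem_iUnion.1 hz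
  have hj0 : (0 : ℝ) ≤ j * d := by positivity
  refine ⟨j, mem_cellEvent_iff.2 ⟨fun b' hb' => ?_, fun h0 => ?_⟩, ?_⟩
  · exact hj.1.trans_le (pow_le_pow_left₀ hdb.le (hmin b' hb') 2)
  · exact (radialSum_indicator_eq_zero _).1 h0 b hb hj
  · rw [hS.lt_sinr_iff hact hdb] at hsinr
    refine lt_of_le_of_lt (add_le_add ?_ (ENNReal.tsum_le_tsum fun b' => ?_)) hsinr
    · refine ENNReal.ofReal_le_ofReal (mul_le_mul_of_nonneg_left ?_ hB)
      exact Real.rpow_le_rpow hj0 hj.1.le (by linarith)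
    · gcongr
      by_cases hb' : S.Available ω b'
      swap
      · simp [hb']
      rw [if_pos hb', farGain]
      by_cases hr : (j + 1) * d < S.dist ω b' ^ 2
      swap
      · simp [hr]
      have hne : b' ≠ b := by
        rintro rfl
        exact hr.not_ge hj.2
      rw [if_pos hr, if_pos ⟨hb', hne⟩]
      gcongr
      exact hj.1.le

/-- The only point of the cell is the nearest one, and all interferers lie beyond r. Moving the
server out to r only hurts the link, so standing up there suffices. -/
theorem IsModel.covered_of_lower_cell (hS : S.IsModel P) {ω : Ω}
    (hact : ∀ b, S.Available ω b → S.active b ω = true) {t r : ℝ} (ht : 0 ≤ t)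
    (h : S.configuration ω ∈ S.cellEvent t r {1} ∧ S.StandsUp r r ω) :
    ∃ b, S.IsServing ω b ∧ ENNReal.ofReal S.T < S.sinr ω b := by
  classical
  obtain ⟨hc, hg⟩ := h
  rw [mem_cellEvent_iff] at hc
  obtain ⟨b, hb, hz, huniq⟩ := exists_of_radialSum_indicator_eq_one _ hc.2
  have hb' : S.Available ω b := hb
  have hzb : S.dist ω b ^ 2 ∈ Ioc t r := hz
  have hα := hS.two_lt_α
  have hT := hS.T_pos
  have hB := hS.B_nonneg
  have hfar : ∀ b', S.Available ω b' → b' ≠ b → r < S.dist ω b' ^ 2 := by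
    intro b' hb' hne
    by_contra hr
    exact hne (huniq b' hb' ⟨hc.1 b' hb', not_lt.1 hr⟩)
  have hd : 0 < S.dist ω b :=
    (dist_nonneg ω b).lt_of_ne' fun h0 => (ht.trans_lt hzb.1).ne' (by rw [h0]; simp)
  refine ⟨b, ⟨hb', fun b' h1 => ?_⟩, (hS.lt_sinr_iff hact hd).2 (lt_of_le_of_lt
    (add_le_add ?_ (ENNReal.tsum_le_tsum fun b' => ?_)) hg)⟩
  · by_cases hne : b' = b
    · rw [hne]
    · exact le_of_lt (lt_of_pow_lt_pow_left₀ 2 (dist_nonneg ω b')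
        (hzb.2.trans_lt (hfar b' h1 hne)))
  · refine ENNReal.ofReal_le_ofReal (mul_le_mul_of_nonneg_left ?_ hB)
    exact Real.rpow_le_rpow (by positivity) hzb.2 (by linarith)
  · gcongr
    by_cases h1 : S.Available ω b' ∧ b' ≠ b
    · rw [if_pos h1, if_pos h1.1, farGain, if_pos (hfar b' h1.1 h1.2)]
      gcongr
      exact hzb.2
    · rw [if_neg h1]
      exact zero_le

theorem IsModel.integralApprox_eq (hS : S.IsModel P) :
    integralApprox S.α S.netIntensity (Real.pi * S.netIntensity * S.beta) S.B =
      S.coverageApprox := by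
  have hρ := hS.intensity_pos
  have hl := hS.netIntensity_pos
  rw [integralApprox, coverageApprox]
  generalize S.B ^ (2 / S.α) / Real.Gamma (2 / S.α) = D
  have h : Real.pi * S.netIntensity * S.beta + S.α / 2 * D =
      Real.pi * S.netIntensity * (S.beta + S.α / (2 * Real.pi * S.netIntensity) * D) := by
    field_simp
  rw [h, mul_inv, mul_inv_cancel_left₀ hρ.ne']

/-! ### The coverage probability and the quality of its approximation. -/

variable [IsProbabilityMeasure P]

/-- Unions of cell events enclose the coverage event up to null sets, so its own measurability is
never needed: subadditivity serves for the upper bound, disjointness for the lower one. -/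
theorem IsModel.coverage_eq_of_measurable (hS : S.IsModel P) (hact : S.AllActive P)
    (hg₀ : Measurable S.g₀) (hg : ∀ b, Measurable (S.g b)) :
    S.coverage P = Real.pi * S.netIntensity * ∫ z in Ioi (0 : ℝ),
      Real.exp (-(Real.pi * S.netIntensity * S.beta * z + S.B * z ^ (S.α / 2))) := by
  have hβ := hS.one_le_beta
  have hα := hS.two_lt_α
  have hB := hS.B_nonneg
  have hρ := hS.intensity_pos
  have hA : 0 < Real.pi * S.netIntensity * S.beta := mul_pos hρ (by linarith)
  refine eq_mul_integral_of_riemann_bounds (f := fun z => Real.exp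
    (-(Real.pi * S.netIntensity * S.beta * z + S.B * z ^ (S.α / 2)))) ?_
    (fun z => (Real.exp_pos _).le) (integrableOn_exp_neg_add_rpow hA hB) hρ measureReal_nonneg
    (fun d hd => ?_) (fun d hd hd1 => ?_)
  · intro x hx y _ hxy
    have hx0 : (0 : ℝ) ≤ x := hx
    refine Real.exp_le_exp.2 (neg_le_neg (add_le_add (by gcongr) ?_))
    exact mul_le_mul_of_nonneg_left (Real.rpow_le_rpow hx0 hxy (by linarith)) hB
  · have hsub : {ω | ∃ b, S.IsServing ω b ∧ ENNReal.ofReal S.T < S.sinr ω b} ≤ᵐ[P]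
        ⋃ j : ℕ, {ω | S.configuration ω ∈ S.cellEvent (j * d) ((j + 1) * d) {0}ᶜ ∧
          S.StandsUp (j * d) ((j + 1) * d) ω} := by
      filter_upwards [hact] with ω hω h
      exact mem_iUnion.2 (hS.exists_upper_cell hω hd h)
    rw [coverage, ofReal_measureReal]
    refine (measure_mono_ae hsub).trans ((measure_iUnion_le _).trans
      (ENNReal.tsum_le_tsum fun j => ?_))
    rw [← ofReal_measureReal]
    refine ENNReal.ofReal_le_ofReal ?_
    have h := hS.measureReal_upper_cell hg₀ hg (t := j * d) (r := (j + 1) * d) (by positivity)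
      (by nlinarith)
    rwa [show (j + 1) * d - j * d = d by ring] at h
  · have hsub : (⋃ j : ℕ, {ω | S.configuration ω ∈ S.cellEvent (j * d) ((j + 1) * d) {1} ∧
        S.StandsUp ((j + 1) * d) ((j + 1) * d) ω}) ≤ᵐ[P]
        {ω | ∃ b, S.IsServing ω b ∧ ENNReal.ofReal S.T < S.sinr ω b} := by
      filter_upwards [hact] with ω hω h
      obtain ⟨j, hj⟩ := mem_iUnion.1 h
      exact hS.covered_of_lower_cell hω (by positivity) hj
    rw [coverage, ofReal_measureReal]
    refine le_trans ?_ (measure_mono_ae hsub)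
    rw [measure_iUnion]
    · refine ENNReal.tsum_le_tsum fun j => ?_
      rw [← ofReal_measureReal]
      refine ENNReal.ofReal_le_ofReal ?_
      -- The free parameter θ is taken equal to the width d, which makes the correction θ(e^(ρd) -
      -- 1) of second order and requires d ≤ 1.
      have h := hS.le_measureReal_lower_cell hg₀ hg (t := j * d) (r := (j + 1) * d)
        (by positivity) (by nlinarith) hd hd1
      rwa [show (j + 1) * d - j * d = d by ring] at h
    -- The point found in cell i lies within squared distance jd, which the void condition of cell j
    -- forbids.
    · have key : ∀ i j : ℕ, i < j → Disjoint
          {ω | S.configuration ω ∈ S.cellEvent (i * d) ((i + 1) * d) {1} ∧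
            S.StandsUp ((i + 1) * d) ((i + 1) * d) ω}
          {ω | S.configuration ω ∈ S.cellEvent (j * d) ((j + 1) * d) {1} ∧
            S.StandsUp ((j + 1) * d) ((j + 1) * d) ω} := by
        intro i j hij
        refine disjoint_left.2 fun ω hi hj => ?_
        obtain ⟨b, hb, hz, -⟩ := exists_of_radialSum_indicator_eq_one _
          (mem_cellEvent_iff.1 hi.1).2
        have h1 : (j : ℝ) * d < S.dist ω b ^ 2 := (mem_cellEvent_iff.1 hj.1).1 b hb
        have h2 : S.dist ω b ^ 2 ≤ (i + 1) * d := hz.2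
        have h3 : (i : ℝ) + 1 ≤ j := by exact_mod_cast hij
        nlinarith
      intro i j hij
      rcases lt_or_gt_of_ne hij with h | h
      exacts [key i j h, (key j i h).symm]
    · exact fun j => IsModel.measurableSet_and_standsUp hg₀ hg
        (measurableSet_cellEvent _ _ (measurableSet_singleton 1)) _ _

/-- `HasLaw` makes the gains only almost everywhere measurable. They are replaced by measurable
versions; the labels are countable, so almost surely no SINR changes. -/
theorem IsModel.coverage_eq (hS : S.IsModel P) (hact : S.AllActive P) :
    S.coverage P = Real.pi * S.netIntensity * ∫ z in Ioi (0 : ℝ),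
      Real.exp (-(Real.pi * S.netIntensity * S.beta * z + S.B * z ^ (S.α / 2))) := by
  let S' : Downlink Ω := { S with
    g₀ := hS.rayleigh.aemeasurable.mk S.g₀
    g := fun b => (hS.gain b).aemeasurable.mk (S.g b) }
  have h₀ : S.g₀ =ᵐ[P] S'.g₀ := hS.rayleigh.aemeasurable.ae_eq_mk
  have h₁ : ∀ b, S.g b =ᵐ[P] S'.g b := fun b => (hS.gain b).aemeasurable.ae_eq_mk
  have hS' : S'.IsModel P :=
    { p_pos := hS.p_pos
      T_pos := hS.T_pos
      two_lt_α := hS.two_lt_α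
      buyer_notMem := hS.buyer_notMem
      intensity_nonneg := hS.intensity_nonneg
      netIntensity_pos := hS.netIntensity_pos
      poisson := hS.poisson
      indep_bs := hS.indep_bs
      rayleigh := hS.rayleigh.congr h₀.symm
      gain := fun b => (hS.gain b).congr (h₁ b).symm
      gain_pos := hS.gain_pos
      gain_moment := hS.gain_moment
      indep_gain := hS.indep_gain.congr fun o => by
        cases o with
        | none => exact h₀
        | some b => exact h₁ b
      indep_gain_bs := hS.indep_gain_bs.congr (by
        filter_upwards [h₀, ae_all_iff.2 h₁] with ω hω₀ hω₁
        exact Prod.ext hω₀ (funext hω₁)) (.rfl) }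
  have h := hS'.coverage_eq_of_measurable hact hS.rayleigh.aemeasurable.measurable_mk
    fun b => (hS.gain b).aemeasurable.measurable_mk
  refine Eq.trans (measureReal_congr ?_) h
  filter_upwards [h₀, ae_all_iff.2 h₁] with ω hω₀ hω₁
  have hs : ∀ b, S.sinr ω b = S'.sinr ω b := fun b => by
    unfold sinr interference
    rw [hω₀]
    simp_rw [hω₁]
    rfl
  exact propext (exists_congr fun b => and_congr Iff.rfl (by rw [hs]))

theorem IsModel.coverage_div_le (hS : S.IsModel P) (hact : S.AllActive P) {d : ℝ} (hd : 0 < d)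
    (h : S.B ≤ d * (Real.pi * S.netIntensity * S.beta) ^ (S.α / 2) ∨
      (Real.pi * S.netIntensity * S.beta) ^ (S.α / 2) ≤ d * S.B) :
    S.coverage P / S.coverageApprox ≤
      1 + max (S.α / 2 / Real.Gamma (2 / S.α)) (Real.Gamma (2 / S.α) / (S.α / 2)) *
        d ^ (2 / S.α) := by
  have hρ := hS.intensity_pos
  have hβ := hS.one_le_beta
  have hα := hS.two_lt_α
  have hA : 0 < Real.pi * S.netIntensity * S.beta := mul_pos hρ (by linarith)
  have h1 := integral_exp_neg_add_rpow_div_le (by linarith) hA hS.B_nonneg hd h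
  rw [one_div_div] at h1
  rwa [← hS.integralApprox_eq, hS.coverage_eq hact, integralApprox, mul_div_mul_left _ _ hρ.ne',
    div_inv_eq_mul]

theorem IsModel.coverageApprox_le_coverage (hS : S.IsModel P) (hact : S.AllActive P) :
    S.coverageApprox ≤ S.coverage P := by
  have hρ := hS.intensity_pos
  have hβ := hS.one_le_beta
  have h := inv_add_le_integral_exp_neg_add_rpow hS.half_α
    (mul_pos hρ (zero_lt_one.trans_le hβ)) hS.B_nonneg
  rw [one_div_div] at h
  rw [← hS.integralApprox_eq, hS.coverage_eq hact, integralApprox]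
  gcongr

theorem IsModel.coverage_le_two_mul (hS : S.IsModel P) (hact : S.AllActive P) :
    S.coverage P ≤ 2 * S.coverageApprox := by
  have hρ := hS.intensity_pos
  have hβ := hS.one_le_beta
  have hα := hS.half_α
  have h := integral_exp_neg_add_rpow_le_two_mul (a := S.α / 2) (by linarith)
    (mul_pos hρ (zero_lt_one.trans_le hβ)) hS.B_nonneg
  rw [one_div_div] at h
  rw [← hS.integralApprox_eq, hS.coverage_eq hact, integralApprox, mul_left_comm]
  gcongr

theorem IsModel.coverageApprox_pos (hS : S.IsModel P) : 0 < S.coverageApprox := by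
  have hl := hS.netIntensity_pos
  have hβ := hS.one_le_beta
  have hα := hS.two_lt_α
  have hB := hS.B_nonneg
  have hG := Real.Gamma_pos_of_pos (s := 2 / S.α) (by positivity)
  have : 0 ≤ S.α / (2 * Real.pi * S.netIntensity) * (S.B ^ (2 / S.α) / Real.Gamma (2 / S.α)) := by
    positivity
  exact inv_pos.2 (by linarith)

end Downlink

end

theorem proposition2 :
    (∀ {Ω : Type*} [MeasurableSpace Ω] (P : Measure Ω) [IsProbabilityMeasure P] (S : Downlink Ω),
      S.IsModel P → S.AllActive P →
        Integrable S.betaIntegrand S.powerLaw ∧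
        S.coverage P = Real.pi * S.netIntensity * ∫ z in Ioi (0 : ℝ),
          Real.exp (-(Real.pi * S.netIntensity * S.beta * z + S.B * z ^ (S.α / 2))) ∧
        integralApprox S.α S.netIntensity (Real.pi * S.netIntensity * S.beta) S.B =
          S.coverageApprox ∧
        S.coverageApprox ≤ S.coverage P ∧ S.coverage P ≤ 2 * S.coverageApprox) ∧
    (∀ α : ℝ, 2 < α → ∀ ε : ℝ, 0 < ε → ∃ δ : ℝ, 0 < δ ∧
      ∀ {Ω : Type*} [MeasurableSpace Ω] (P : Measure Ω) [IsProbabilityMeasure P] (S : Downlink Ω),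
        S.IsModel P → S.AllActive P → S.α = α →
        (S.B ≤ δ * (Real.pi * S.netIntensity * S.beta) ^ (α / 2) ∨
          (Real.pi * S.netIntensity * S.beta) ^ (α / 2) ≤ δ * S.B) →
        |S.coverage P / S.coverageApprox - 1| ≤ ε) := by
  refine ⟨fun P _ S hS hact => ⟨hS.integrable_betaIntegrand, hS.coverage_eq hact,
    hS.integralApprox_eq, hS.coverageApprox_le_coverage hact, hS.coverage_le_two_mul hact⟩,
    fun α hα ε hε => ?_⟩
  have hα0 : 0 < α := by linarith
  have hG := Real.Gamma_pos_of_pos (s := 2 / α) (by positivity)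
  set M := max (α / 2 / Real.Gamma (2 / α)) (Real.Gamma (2 / α) / (α / 2)) with hM
  have hM0 : 0 < M := lt_max_of_lt_left (by positivity)
  -- Chosen so that the error bound M δ^(2/α) equals ε.
  refine ⟨(ε / M) ^ (α / 2), by positivity, ?_⟩
  intro Ω _ P _ S hS hact hSα h
  subst hSα
  have h1 := hS.coverage_div_le hact (by positivity) h
  have hpow : ((ε / M) ^ (S.α / 2)) ^ (2 / S.α) = ε / M := by
    rw [← Real.rpow_mul (by positivity), div_mul_div_cancel₀ two_ne_zero, div_self hα0.ne',
      Real.rpow_one]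
  rw [← hM, hpow, mul_div_cancel₀ _ hM0.ne'] at h1
  have h2 : 1 ≤ S.coverage P / S.coverageApprox :=
    (one_le_div hS.coverageApprox_pos).2 (hS.coverageApprox_le_coverage hact)
  rw [abs_of_nonneg (by linarith)]
  linarith
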